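/- Let $\ell$ be a prime and $K$ a field with $\operatorname{char} K\neq\ell$ and $\mu_\ell\subset K$. **Definitions.** Let $F$ be any field. *Valuations.* Valuations are Krull valuations, possibly trivial; $\mathcal O_v$, $\mathfrak m_v$, $k(v)$ denote the valuation ring, the maximal ideal and the residue field. A subgroup $H\le F^\times$ is *valuative* if $\mathcal O_v^\times\le H$ for some valuation $v$ of $F$; then $v_H$ denotes the coarsest valuation $v$ of $F$ with $\mathcal O_v^\times\le H$. *The mod-$\ell$ notions.* A subgroup $T$ with $F^{\times\ell}\le T\le F^\times$ is *rigid* if for every $x\in F^\times\smallsetminus T$ the subgroup of $F^\times/T$ generated by $x$ and $1-x$ is cyclic. If $-1\in T$ in addition, $\mathbf H(T)$ is the intersection of all $H$ with $T\le H\le F^\times$ such that $F^\times/H$ is cyclic (possibly trivial) and such that $H\cap H'$ is rigid for every $H'$ with $T\le H'\le F^\times$ and $F^\times/H'$ cyclic. *The pro-$\ell$ notions.* Let $\widehat F=\varprojlim_n F^\times/F^{\times\ell^n}$, a $\mathbb Z_\ell$-module with its inverse limit topology ($F^\times/F^{\times \ell^n}$ discrete); all submodules below are closed $\mathbb Z_\ell$-submodules.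 For $\widehat T\le\widehat F$, let $F^\times\cap\widehat T$ be the preimage of $\widehat T$ under the canonical map $F^\times\to\widehat F$; for $x\in F^\times$ or $S\subset F^\times$, $x\in\widehat T$ and $S\le\widehat T$ mean $x\in F^\times\cap\widehat T$ and $S\subset F^\times\cap\widehat T$. Call $\widehat T$ *rigid* if for every $x\in F^\times$ with $x\notin\widehat T$ the $\mathbb Z_\ell$-submodule of $\widehat F/\widehat T$ generated by $x$ and $1-x$ is cyclic. Call $\widehat H\le\widehat F$ *valuative* if $F^\times\cap\widehat H$ is valuative, and then put $v_{\widehat H}=v_{F^\times\cap\widehat H}$. If $\widehat F/\widehat T$ is torsion-free, $\mathbf H(\widehat T)$ is the intersection of all $\widehat H$ with $\widehat T\le\widehat H\le\widehat F$ such that $\widehat F/\widehat H$ is torsion-free and $\mathbb Z_\ell$-cyclic (possibly trivial) and such that $\widehat H\cap\widehat H'$ is rigid for every $\widehat H'$ with $\widehat T\le\widehat H'\le\widehat F$ and $\widehat F/\widehat H'$ torsion-free and $\mathbb Z_\ell$-cyclic. **Statement (mod-$\ell$ case).** Let $-1\in T\le K^\times$ and put $L=K(\sqrt[\ell]{T})$.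 Suppose that there is a subgroup $T'\le L^\times$ with $L^{\times\ell}\le T'$, $T'\cap K^\times=T$ and $T'=\mathbf H(T')$. Then $T=\mathbf H(T)$, and there is a valuative subgroup $H$ with $T\le H\le K^\times$ and $H/T$ cyclic (possibly trivial) such that, for $v=v_H$, $$1+\mathfrak m_v\le T,\qquad \mathcal O_v^\times\le H,\qquad \operatorname{char}k(v)\neq\ell .$$ **Statement (pro-$\ell$ case).** Assume furthermore that $\mu_{\ell^\infty}\subset K$. Let $\widehat T\le\widehat K$ be such that $\widehat K/\widehat T$ is torsion-free and put $L=K\bigl(\sqrt[\ell^\infty]{K^\times\cap\widehat T}\bigr)$, the field generated over $K$ by all $\ell^n$-th roots ($n\ge 0$) of elements of $K^\times\cap\widehat T$. Suppose that there is $\widehat T'\le\widehat L$ such that $\widehat L/\widehat T'$ is torsion-free, $\widehat T'=\mathbf H(\widehat T')$, and the preimage of $\widehat T'$ under the canonical map $\widehat K\to\widehat L$ is $\widehat T$. Then $\widehat T=\mathbf H(\widehat T)$, and there is a valuative $\widehat H$ with $\widehat T\le\widehat H\le\widehat K$ and $\widehat H/\widehat T$ cyclic over $\mathbb Z_\ell$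 (possibly trivial) such that, for $v=v_{\widehat H}$, $$1+\mathfrak m_v\le\widehat T,\qquad \mathcal O_v^\times\le\widehat H,\qquad \operatorname{char}k(v)\neq\ell .$$ -/

import Mathlib

namespace RigidVal

section ModEll

variable {K : Type*} [Field K]

/-- A subgroup `H ≤ Kˣ` is valuative if it contains the units of some
(possibly trivial) Krull valuation ring of `K`. -/
def IsValuative (H : Subgroup Kˣ) : Prop :=
  ∃ A : ValuationSubring K, A.unitGroup ≤ H

/-- `A` is the valuation ring of the canonical valuation `v_H`: the coarsest valuation (that is, the
largest valuation ring) of `K` whose units lie in `H`. There is at most one such `A`. -/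
def IsCanonicalValuation (A : ValuationSubring K) (H : Subgroup Kˣ) : Prop :=
  IsGreatest {B : ValuationSubring K | B.unitGroup ≤ H} A

/-- `T` is rigid if `x` and `1 - x` generate a cyclic subgroup of `Kˣ / T` for all `x ∉ T`.
(Here `y` is the unit `1 - x`.) -/
def IsRigid (T : Subgroup Kˣ) : Prop :=
  ∀ x y : Kˣ, (y : K) = 1 - (x : K) → x ∉ T →
    IsCyclic (Subgroup.closure ({(x : Kˣ ⧸ T), (y : Kˣ ⧸ T)} : Set (Kˣ ⧸ T)))

/-- The subgroup `𝐇(T)` of `Kˣ`. -/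
def boldH (T : Subgroup Kˣ) : Subgroup Kˣ :=
  sInf {H : Subgroup Kˣ | T ≤ H ∧ IsCyclic (Kˣ ⧸ H) ∧
    ∀ H' : Subgroup Kˣ, T ≤ H' → IsCyclic (Kˣ ⧸ H') → IsRigid (H ⊓ H')}

/-- The extension `K(T^{1/ℓ})` inside an algebraic closure of `K`. -/
noncomputable def kummerExt (ℓ : ℕ) (T : Subgroup Kˣ) : IntermediateField K (AlgebraicClosure K) :=
  IntermediateField.adjoin K
    {y | ∃ t ∈ T, y ^ ℓ = algebraMap K (AlgebraicClosure K) (t : K)}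

/-- The extension `K(T^{1/ℓ^∞})` inside an algebraic closure of `K`. -/
noncomputable def kummerExtInfty (ℓ : ℕ) (T : Subgroup Kˣ) : IntermediateField K (AlgebraicClosure K) :=
  IntermediateField.adjoin K
    {y | ∃ n : ℕ, ∃ t ∈ T, y ^ ℓ ^ n = algebraMap K (AlgebraicClosure K) (t : K)}

end ModEll

section ProEll

/-- The ideal `ℓ ℤ`. -/
abbrev ellIdeal (ℓ : ℕ) : Ideal ℤ := Ideal.span {(ℓ : ℤ)}

/-- The ring `ℤ_ℓ = lim ℤ / ℓ ^ n`. -/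
abbrev ZEll (ℓ : ℕ) : Type := AdicCompletion (ellIdeal ℓ) ℤ

/-- The `ℓ`-adic completion `lim Kˣ / ℓ ^ n` of the multiplicative group of `K` (written additively),
a module over `ℤ_ℓ`. -/
abbrev KHat (ℓ : ℕ) (K : Type*) [Field K] : Type _ := AdicCompletion (ellIdeal ℓ) (Additive Kˣ)

variable {ℓ : ℕ} {K : Type*} [Field K]

/-- The canonical map from `Kˣ` to its completion. -/
noncomputable def toHat (ℓ : ℕ) {K : Type*} [Field K] (x : Kˣ) : KHat ℓ K :=
  AdicCompletion.of (ellIdeal ℓ) (Additive Kˣ) (Additive.ofMul x)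

/-- `T` is closed in the inverse limit topology, that is, `T` is the set of compatible systems whose
`n`-th component lies in the image `T_n ≤ Kˣ / ℓ ^ n` of `T` for every `n`. -/
def IsClosedSub (T : Submodule (ZEll ℓ) (KHat ℓ K)) : Prop :=
  ∀ x : KHat ℓ K,
    (∀ n : ℕ, ∃ t ∈ T, AdicCompletion.eval (ellIdeal ℓ) (Additive Kˣ) n t =
      AdicCompletion.eval (ellIdeal ℓ) (Additive Kˣ) n x) → x ∈ T

/-- The subgroup `Kˣ ∩ T` of `Kˣ`: the inverse image of `T` under the completion map. -/
def capUnits (T : Submodule (ZEll ℓ) (KHat ℓ K)) : Subgroup Kˣ where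
  carrier := {x | toHat ℓ x ∈ T}
  mul_mem' {a b} ha hb := by
    simp only [Set.mem_ofPred_eq, toHat, ofMul_mul, map_add] at *
    exact T.add_mem ha hb
  one_mem' := by
    simp only [Set.mem_ofPred_eq, toHat, ofMul_one, map_zero]
    exact T.zero_mem
  inv_mem' {a} ha := by
    simp only [Set.mem_ofPred_eq, toHat, ofMul_inv, map_neg] at *
    exact T.neg_mem ha

/-- `T` is rigid if `x` and `1 - x` generate a cyclic `ℤ_ℓ`-submodule of the quotient by `T` for all
`x ∈ Kˣ` that are not in `T`. (Here `y` is the unit `1 - x`.) -/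
def IsRigidHat (T : Submodule (ZEll ℓ) (KHat ℓ K)) : Prop :=
  ∀ x y : Kˣ, (y : K) = 1 - (x : K) → x ∉ capUnits T →
    (Submodule.span (ZEll ℓ) {T.mkQ (toHat ℓ x), T.mkQ (toHat ℓ y)}).IsPrincipal

/-- `H` is a closed submodule containing `T` whose quotient is torsion-free and cyclic
(possibly trivial) over `ℤ_ℓ`. -/
def IsTorsionFreeCocyclic (T H : Submodule (ZEll ℓ) (KHat ℓ K)) : Prop :=
  T ≤ H ∧ IsClosedSub H ∧ Module.IsTorsionFree (ZEll ℓ) (KHat ℓ K ⧸ H) ∧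
    (⊤ : Submodule (ZEll ℓ) (KHat ℓ K ⧸ H)).IsPrincipal

/-- The submodule `𝐇(T)` of the completion. -/
noncomputable def boldHHat (T : Submodule (ZEll ℓ) (KHat ℓ K)) : Submodule (ZEll ℓ) (KHat ℓ K) :=
  sInf {H | IsTorsionFreeCocyclic T H ∧
    ∀ H', IsTorsionFreeCocyclic T H' → IsRigidHat (H ⊓ H')}

/-- The map between completions induced by a field extension. -/
noncomputable def hatMap (ℓ : ℕ) (K L : Type*) [Field K] [Field L] [Algebra K L] :
    KHat ℓ K →ₗ[ZEll ℓ] KHat ℓ L :=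
  AdicCompletion.map (ellIdeal ℓ)
    (MonoidHom.toAdditive (Units.map (algebraMap K L : K →* L))).toIntLinearMap

end ProEll

end RigidVal

open RigidVal

/-! The equation `𝐇(T') = T'` is first turned into linear algebra: modulo `T'`, the classes of `x`
and `1 - x` are always dependent. Indeed some cocyclic `H` in the defining family separates `x` from
`T'`, a combination `w` of `x` and `1 - x` lies in `H`, and a cocyclic `H'` with `w ∉ H'` would
contradict rigidity of `H ⊓ H'` (`exists_zpow_of_boldH_eq`, `exists_smul_add_smul_of_boldHHat_eq`).
Dependence restricts to `K`, where it makes every group above `T` rigid. Hence each `H` of the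
family for `T'` pulls back into the family for `T`, and `𝐇(T) = T`.

For the valuation, let `φ` be the quotient map of `Lˣ` by `T'`, into a vector space over `𝔽_ℓ` or
over the fraction field of `ℤ_ℓ`. Dependence says that `φ u`, `φ v`, `φ (u + v)` are always
collinear. Call `x` wild if `1 + x ∉ T' ∪ xT'`. Two wild elements with independent images would
force `φ` to follow a projective map on the elements `r + x`, with `r` a natural number, whose
denominators `r + α` never vanish. This is absurd over `𝔽_ℓ`, and incompatible with integrality over
`ℤ_ℓ` (`IsWild.dependent`). So all wild elements lie over one line, and off that line rigidity
yields a valuation ring `A` of `L`: `1 + 𝔪` is killed by `φ`, and the units map into a line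
(`exists_valuationSubring_of_dependent`). For `ℓ = 2` there are no wild elements, but squares no
longer help, and one exceptional class may have to be added.

If `ℓ` is a unit of `A`, restrict `A` to `K`. Otherwise use the roots in `L`: for `a` in `K` with
value between that of `ℓ` and `1`, the element `1 + a` lies in `T`, so it has `ℓ`-power roots in
`L`. Extracting them shows that `φ a` is divisible enough to vanish. Therefore `φ` kills all units
of the coarsening of `A ∩ K` obtained by inverting `ℓ` (`exists_unitGroup_le_of_roots`). Passing to
the coarsest valuation only shrinks the principal units and keeps `ℓ` invertible. -/

namespace RigidVal

/-! ### Valuation rings from rigid pairs -/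

section RigidPair

variable {K : Type*} [Field K]

/-- A pair of multiplicative subgroups `T ≤ H` of a field, written as submonoids of the field, such
that `1 + x ∈ T ∪ xT` for all `x` outside `H`. -/
structure RigidPair (T H : Submonoid K) : Prop where
  le : T ≤ H
  zero : (0 : K) ∉ H
  invT : ∀ x ∈ T, x⁻¹ ∈ T
  invH : ∀ x ∈ H, x⁻¹ ∈ H
  neg_one : (-1 : K) ∈ T
  rigid : ∀ x : K, x ≠ 0 → x ∉ H → 1 + x ∈ T ∨ ∃ t ∈ T, 1 + x = t * x

/-- The elements outside `H` that are small with respect to the pair `T ≤ H`. -/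
def smallSet (T H : Submonoid K) : Set K := {x | x ≠ 0 ∧ x ∉ H ∧ 1 + x ∈ T}

namespace RigidPair

variable {T H : Submonoid K} (h : RigidPair T H)
include h

lemma ne_zero {x : K} (hx : x ∈ H) : x ≠ 0 := fun e => h.zero (e ▸ hx)

lemma ne_zero' {x : K} (hx : x ∈ T) : x ≠ 0 := h.ne_zero (h.le hx)

lemma mul_mem_iff {x t : K} (ht : t ∈ H) : x * t ∈ H ↔ x ∈ H := by
  refine ⟨fun hx => ?_, fun hx => H.mul_mem hx ht⟩
  have := H.mul_mem hx (h.invH _ ht)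
  rwa [mul_assoc, mul_inv_cancel₀ (h.ne_zero ht), mul_one] at this

lemma mul_mem_iff' {x t : K} (ht : t ∈ H) : t * x ∈ H ↔ x ∈ H := by
  rw [mul_comm, h.mul_mem_iff ht]

lemma div_mem_iff {x t : K} (ht : t ∈ H) : x / t ∈ H ↔ x ∈ H := by
  rw [div_eq_mul_inv, h.mul_mem_iff (h.invH _ ht)]

lemma inv_mem_iff {x : K} : x⁻¹ ∈ H ↔ x ∈ H :=
  ⟨fun hx => by simpa using h.invH _ hx, h.invH x⟩

lemma neg_mem_iff {x : K} : -x ∈ H ↔ x ∈ H := by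
  rw [← neg_one_mul, h.mul_mem_iff' (h.le h.neg_one)]

lemma divT {x y : K} (hx : x ∈ T) (hy : y ∈ T) : x / y ∈ T := by
  rw [div_eq_mul_inv]; exact T.mul_mem hx (h.invT _ hy)

/-- Dividing `1 + x = t * x` by `x` gives `1 + x⁻¹ = t`. Together with `inv_notMem_smallSet`,
exactly one of `x`, `x⁻¹` is small, as for a valuation off its units. -/
lemma mem_smallSet_or_inv {x : K} (hx : x ≠ 0) (hxH : x ∉ H) :
    x ∈ smallSet T H ∨ x⁻¹ ∈ smallSet T H := by
  rcases h.rigid x hx hxH with ht | ⟨t, ht, e⟩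
  · exact Or.inl ⟨hx, hxH, ht⟩
  · refine Or.inr ⟨inv_ne_zero hx, fun hi => hxH (h.inv_mem_iff.1 hi), ?_⟩
    have : 1 + x⁻¹ = t := by field_simp; linear_combination e
    rwa [this]

lemma inv_notMem_smallSet {x : K} (hx : x ∈ smallSet T H) : x⁻¹ ∉ smallSet T H := by
  rintro ⟨-, -, hi⟩
  obtain ⟨hx0, hxH, ht⟩ := hx
  apply hxH
  have : x = (1 + x) / (1 + x⁻¹) := by
    have h1 := h.ne_zero' hi
    have h2 : x + 1 ≠ 0 := by rw [add_comm]; exact h.ne_zero' ht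
    field_simp
    ring
  rw [this]
  exact h.le (h.divT ht hi)

/-- Factor `1 + x(1 + y) = (1 + x)(1 + xy/(1 + x))`. Rigidity at `x(1 + y)` puts this in the class
of `1` or of `x` modulo `T`, rigidity at `xy/(1 + x)` in the class of `1` or of `xy`. Since `y ∉ T`,
the common class is `1`. -/
lemma one_add_mul_mem {x y : K} (hx : x ∈ smallSet T H) (hy : y ∈ smallSet T H)
    (hxy : x * y ∉ H) : 1 + x * (1 + y) ∈ T := by
  obtain ⟨hx0, hxH, hxT⟩ := hx
  obtain ⟨hy0, hyH, hyT⟩ := hy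
  have hx1 := h.ne_zero' hxT
  have hy1 := h.ne_zero' hyT
  have e2 : (1 + x) * (1 + x * y / (1 + x)) = 1 + x * (1 + y) := by field_simp; ring
  rcases h.rigid (x * (1 + y)) (mul_ne_zero hx0 hy1) (by rwa [h.mul_mem_iff (h.le hyT)]) with
    ht | ⟨t, ht, e⟩
  · exact ht
  rcases h.rigid (x * y / (1 + x)) (div_ne_zero (mul_ne_zero hx0 hy0) hx1)
    (by rwa [h.div_mem_iff (h.le hxT)]) with ht' | ⟨t', ht', e'⟩
  · rw [← e2]; exact T.mul_mem hxT ht'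
  · exfalso
    apply hyH
    have e3 : t * (1 + y) = t' * y := by
      rw [e', e] at e2
      field_simp at e2
      exact e2.symm
    have : y = t * (1 + y) / t' := by
      rw [e3]; field_simp [h.ne_zero' ht']
    rw [this]
    exact h.le (h.divT (T.mul_mem ht hyT) ht')

lemma mul_one_add_mem {x y : K} (hx : x ∈ smallSet T H) (hy : y ∈ smallSet T H)
    (hxy : x * y ∉ H) : x * (1 + y) ∈ smallSet T H :=
  ⟨mul_ne_zero hx.1 (h.ne_zero' hy.2.2), by rw [h.mul_mem_iff (h.le hy.2.2)]; exact hx.2.1,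
    h.one_add_mul_mem hx hy hxy⟩

lemma mul_div_one_add_mem {x y : K} (hx : x ∈ smallSet T H) (hy : y ∈ smallSet T H)
    (hxy : x * y ∉ H) : x * y / (1 + x) ∈ smallSet T H := by
  have hx1 := h.ne_zero' hx.2.2
  refine ⟨div_ne_zero (mul_ne_zero hx.1 hy.1) hx1, by rwa [h.div_mem_iff (h.le hx.2.2)], ?_⟩
  have : 1 + x * y / (1 + x) = (1 + x * (1 + y)) / (1 + x) := by field_simp; ring
  rw [this]
  exact h.divT (h.one_add_mul_mem hx hy hxy) hx.2.2

lemma neg_div_one_add_mem {x : K} (hx : x ∈ smallSet T H) : -x / (1 + x) ∈ smallSet T H := by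
  have hx1 := h.ne_zero' hx.2.2
  refine ⟨div_ne_zero (neg_ne_zero.2 hx.1) hx1, ?_, ?_⟩
  · rw [h.div_mem_iff (h.le hx.2.2), h.neg_mem_iff]; exact hx.2.1
  · have : 1 + -x / (1 + x) = (1 + x)⁻¹ := by field_simp; ring
    rw [this]; exact h.invT _ hx.2.2

/-- If the small elements are closed under the operations below, they come from a valuation. -/
theorem exists_valuationSubring
    (hneg : ∀ x ∈ smallSet T H, -x ∈ smallSet T H)
    (hmul : ∀ x ∈ smallSet T H, ∀ y ∈ smallSet T H, x * y ∉ H → x * y ∈ smallSet T H)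
    (hmul3 : ∀ x ∈ smallSet T H, ∀ y ∈ smallSet T H, ∀ z ∈ smallSet T H,
      x * y * z ∉ H → x * y * z ∈ smallSet T H)
    (hadd : ∀ x ∈ smallSet T H, ∀ y ∈ smallSet T H, y * (1 + x) ∈ smallSet T H) :
    ∃ A : ValuationSubring K, (∀ x : K, x ≠ 0 → x ∈ A → x⁻¹ ∈ A → x ∈ H) ∧
      ∀ x ∈ A, x⁻¹ ∉ A → 1 + x ∈ T := by
  -- The ring will be `{0} ∪ U ∪ S`: outside `H` integrality means smallness, and inside `H` it
  -- means preserving `S` under multiplication.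
  set S := smallSet T H with hS
  set U : Set K := {x | x ∈ H ∧ ∀ y ∈ S, x * y ∈ S} with hU
  have h1U : (1 : K) ∈ U := ⟨H.one_mem, fun y hy => by rwa [one_mul]⟩
  have hnegU : (-1 : K) ∈ U := ⟨h.le h.neg_one, fun y hy => by rw [neg_one_mul]; exact hneg y hy⟩
  have hSS : ∀ x ∈ S, ∀ y ∈ S, x * y ∈ H → x * y ∈ U := fun x hx y hy hxy =>
    ⟨hxy, fun z hz => hmul3 x hx y hy z hz (by rw [h.mul_mem_iff' hxy]; exact hz.2.1)⟩
  have hUS : ∀ x ∈ U, ∀ y ∈ S, x * y ∈ S := fun x hx y hy => hx.2 y hy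
  have hUU : ∀ x ∈ U, ∀ y ∈ U, x * y ∈ U := fun x hx y hy =>
    ⟨H.mul_mem hx.1 hy.1, fun z hz => by rw [mul_assoc]; exact hx.2 _ (hy.2 z hz)⟩
  -- A failure `x * a ∉ S` makes `(x * a)⁻¹` small, so `x⁻¹ = (x * a)⁻¹ * a`. The elements of the
  -- maximal ideal inside `H` are thus products of two small elements.
  have hUinv : ∀ x ∈ H, x ∉ U → ∃ p ∈ S, ∃ q ∈ S, x⁻¹ = p * q := by
    intro x hx hxU
    have : ∃ a ∈ S, x * a ∉ S := by
      by_contra! hc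
      exact hxU ⟨hx, hc⟩
    obtain ⟨a, ha, hxa⟩ := this
    have hx0 := h.ne_zero hx
    have ha0 := ha.1
    have := (h.mem_smallSet_or_inv (mul_ne_zero hx0 ha0)
      (by rw [h.mul_mem_iff' hx]; exact ha.2.1)).resolve_left hxa
    exact ⟨_, this, a, ha, by field_simp⟩
  have hUinv' : ∀ x ∈ H, x ∉ U → x⁻¹ ∈ U := by
    intro x hx hxU
    obtain ⟨p, hp, q, hq, e⟩ := hUinv x hx hxU
    rw [e]
    exact hSS p hp q hq (by rw [← e]; exact h.invH _ hx)
  have h1S : ∀ x ∈ S, 1 + x ∈ U := fun x hx =>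
    ⟨h.le hx.2.2, fun y hy => by rw [mul_comm]; exact hadd x hx y hy⟩
  have h1Sinv : ∀ x ∈ S, (1 + x)⁻¹ ∈ U := by
    intro x hx
    have hx1 := h.ne_zero' hx.2.2
    have := h1S _ (h.neg_div_one_add_mem hx)
    have e : 1 + -x / (1 + x) = (1 + x)⁻¹ := by field_simp; ring
    rwa [e] at this
  have hpq : ∀ p ∈ S, ∀ q ∈ S, 1 + p * q ∈ T := by
    intro p hp q hq
    have hnp := hneg p hp
    have hnp1 := h.ne_zero' hnp.2.2
    -- Chosen so that `1 + r = 1 / (1 - p)`, which turns `1 + p * q` into the quotient of `1 + r *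
    -- (1 + q)` by `1 + r`.
    set r := p / (1 + -p) with hr
    have hrS : r ∈ S := by
      have := h.neg_div_one_add_mem hnp
      rwa [neg_neg] at this
    have hr1 := hrS.2.2
    have h3 := (hadd q hq r hrS).2.2
    have h4 := h.divT h3 hr1
    have e : (1 + r * (1 + q)) / (1 + r) = 1 + p * q := by
      have : 1 + r = 1 / (1 + -p) := by rw [hr]; field_simp; ring
      rw [this, hr]; field_simp; ring
    rwa [e] at h4
  have hUadd : ∀ x ∈ U, 1 + x ≠ 0 → 1 + x ∈ U ∪ S := by
    intro x hx hx0
    by_cases hH : 1 + x ∈ H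
    · left
      refine ⟨hH, fun y hy => ?_⟩
      have hy1 := h.ne_zero' hy.2.2
      refine ⟨mul_ne_zero hx0 hy.1, by rw [h.mul_mem_iff' hH]; exact hy.2.1, ?_⟩
      have h1 : (1 + y)⁻¹ * (x * y) ∈ S := hUS _ (h1Sinv y hy) _ (hUS x hx y hy)
      have := T.mul_mem hy.2.2 h1.2.2
      have e : (1 + y) * (1 + (1 + y)⁻¹ * (x * y)) = 1 + (1 + x) * y := by field_simp; ring
      rwa [e] at this
    · right
      by_contra hc
      have h1 := (h.mem_smallSet_or_inv hx0 hH).resolve_left hc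
      have h2 := (hneg _ h1).2.2
      have e : (1 + -(1 + x)⁻¹) * (1 + x) = x := by field_simp; ring
      apply hH
      rw [← h.mul_mem_iff' (h.le h2), e]
      exact hx.1
  let C : Set K := {x | x = 0 ∨ x ∈ U ∨ x ∈ S}
  have hC1 : ∀ x ∈ C, 1 + x ∈ C := by
    rintro x (rfl | hx | hx)
    · rw [add_zero]; exact Or.inr (Or.inl h1U)
    · by_cases h0 : 1 + x = 0
      · exact Or.inl h0
      · exact Or.inr (hUadd x hx h0)
    · exact Or.inr (Or.inl (h1S x hx))
  have hCmul : ∀ x ∈ C, ∀ y ∈ C, x * y ∈ C := by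
    rintro x (rfl | hx | hx) y (rfl | hy | hy)
    · exact Or.inl (by simp)
    · exact Or.inl (by simp)
    · exact Or.inl (by simp)
    · exact Or.inl (by simp)
    · exact Or.inr (Or.inl (hUU x hx y hy))
    · exact Or.inr (Or.inr (hUS x hx y hy))
    · exact Or.inl (by simp)
    · exact Or.inr (Or.inr (by rw [mul_comm]; exact hUS y hy x hx))
    · by_cases hH : x * y ∈ H
      · exact Or.inr (Or.inl (hSS x hx y hy hH))
      · exact Or.inr (Or.inr (hmul x hx y hy hH))
  have hCval : ∀ x : K, x ∈ C ∨ x⁻¹ ∈ C := by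
    intro x
    by_cases h0 : x = 0
    · exact Or.inl (Or.inl h0)
    by_cases hH : x ∈ H
    · by_cases hxU : x ∈ U
      · exact Or.inl (Or.inr (Or.inl hxU))
      · exact Or.inr (Or.inr (Or.inl (hUinv' x hH hxU)))
    · rcases h.mem_smallSet_or_inv h0 hH with h1 | h1
      · exact Or.inl (Or.inr (Or.inr h1))
      · exact Or.inr (Or.inr (Or.inr h1))
  have hCadd : ∀ x ∈ C, ∀ y ∈ C, x + y ∈ C := by
    intro x hx y hy
    by_cases hx0 : x = 0
    · rw [hx0, zero_add]; exact hy
    by_cases hy0 : y = 0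
    · rw [hy0, add_zero]; exact hx
    rcases hCval (y / x) with h1 | h1
    · have := hCmul x hx _ (hC1 _ h1)
      have e : x * (1 + y / x) = x + y := by field_simp
      rwa [e] at this
    · have := hCmul y hy _ (hC1 _ h1)
      have e : y * (1 + (y / x)⁻¹) = x + y := by field_simp; ring
      rwa [e] at this
  let A : ValuationSubring K :=
    { carrier := C
      mul_mem' := fun hx hy => hCmul _ hx _ hy
      one_mem' := Or.inr (Or.inl h1U)
      add_mem' := fun hx hy => hCadd _ hx _ hy
      zero_mem' := Or.inl rfl
      neg_mem' := fun {x} hx => by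
        have := hCmul _ (Or.inr (Or.inl hnegU)) x hx
        rwa [neg_one_mul] at this
      mem_or_inv_mem' := hCval }
  have hA : ∀ x, x ∈ A ↔ x = 0 ∨ x ∈ U ∨ x ∈ S := fun x => Iff.rfl
  refine ⟨A, fun x hx0 hx hxi => ?_, fun x hx hxi => ?_⟩
  · rcases (hA x).1 hx with h1 | h1 | h1
    · exact absurd h1 hx0
    · exact h1.1
    · rcases (hA _).1 hxi with h2 | h2 | h2
      · exact absurd h2 (inv_ne_zero hx0)
      · exact h.inv_mem_iff.1 h2.1
      · exact absurd h2 (h.inv_notMem_smallSet h1)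
  · rcases (hA x).1 hx with h1 | h1 | h1
    · rw [h1, add_zero]; exact T.one_mem
    · have hx0 := h.ne_zero h1.1
      have : x⁻¹ ∉ U := fun hc => hxi ((hA _).2 (Or.inr (Or.inl hc)))
      obtain ⟨p, hp, q, hq, e⟩ := hUinv _ (h.invH _ h1.1) this
      rw [inv_inv] at e
      rw [e]
      exact hpq p hp q hq
    · exact h1.2.2

/-- If `Kˣ / H` has no `2`-torsion, then a rigid pair comes from a valuation. -/
theorem exists_valuationSubring_of_sq (hsq : ∀ x : K, x ^ 2 ∈ H → x ∈ H) :
    ∃ A : ValuationSubring K, (∀ x : K, x ≠ 0 → x ∈ A → x⁻¹ ∈ A → x ∈ H) ∧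
      ∀ x ∈ A, x⁻¹ ∉ A → 1 + x ∈ T := by
  have hneg : ∀ x ∈ smallSet T H, -x ∈ smallSet T H := by
    intro x hx
    refine ⟨neg_ne_zero.2 hx.1, by rw [h.neg_mem_iff]; exact hx.2.1, ?_⟩
    rcases h.rigid (-x) (neg_ne_zero.2 hx.1) (by rw [h.neg_mem_iff]; exact hx.2.1) with
      ht | ⟨t, ht, e⟩
    · exact ht
    exfalso
    have hx2 : x ^ 2 ∉ H := fun hc => hx.2.1 (hsq x hc)
    -- If `1 - x` were in the class of `x`, so would be `1 - x²`; rigidity at `-x²` only allows the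
    -- classes of `1` and `x²`.
    have e2 : 1 + -x ^ 2 = (1 + x) * (t * -x) := by rw [← e]; ring
    have hs := T.mul_mem (T.mul_mem hx.2.2 ht) h.neg_one
    rcases h.rigid (-x ^ 2) (neg_ne_zero.2 (pow_ne_zero 2 hx.1)) (by rwa [h.neg_mem_iff]) with
      ht' | ⟨t', ht', e'⟩
    · apply hx.2.1
      rw [← h.mul_mem_iff' (h.le hs)]
      have : (1 + x) * t * -1 * x = 1 + -x ^ 2 := by rw [e2]; ring
      rw [this]; exact h.le ht'
    · apply hx.2.1
      rw [e'] at e2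
      have : x = (1 + x) * t / t' := by
        have := h.ne_zero' ht'
        have := hx.1
        field_simp
        apply mul_right_cancel₀ this
        linear_combination -e2
      rw [this]
      exact h.le (h.divT (T.mul_mem hx.2.2 ht) ht')
  have hmul : ∀ x ∈ smallSet T H, ∀ y ∈ smallSet T H, x * y ∉ H → x * y ∈ smallSet T H := by
    intro x hx y hy hxy
    have hnx := hneg x hx
    have hnx1 := h.ne_zero' hnx.2.2
    have hr := h.neg_div_one_add_mem hnx
    rw [neg_neg] at hr
    have hr1 := h.ne_zero' hr.2.2
    have := h.mul_div_one_add_mem hr hy (by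
      rwa [div_mul_eq_mul_div, h.div_mem_iff (h.le hnx.2.2)])
    have e : x / (1 + -x) * y / (1 + x / (1 + -x)) = x * y := by
      have : 1 + x / (1 + -x) = 1 / (1 + -x) := by field_simp; ring
      rw [this]; field_simp
    rwa [e] at this
  refine h.exists_valuationSubring hneg hmul ?_ ?_
  · intro x hx y hy z hz hxyz
    by_cases hxy : x * y ∈ H
    · by_cases hyz : y * z ∈ H
      · by_cases hxz : x * z ∈ H
        · exfalso
          apply hx.2.1
          apply hsq
          have hy0 := hy.1
          have hz0 := hz.1
          have : x ^ 2 = x * y * (x * z) / (y * z) := by field_simp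
          rw [this, h.div_mem_iff hyz]
          exact H.mul_mem hxy hxz
        · have e : x * z * y = x * y * z := by ring
          rw [← e] at hxyz ⊢
          exact hmul _ (hmul x hx z hz hxz) y hy hxyz
      · rw [mul_assoc] at hxyz ⊢
        exact hmul x hx _ (hmul y hy z hz hyz) hxyz
    · exact hmul _ (hmul x hx y hy hxy) z hz hxyz
  · intro x hx y hy
    by_cases hxy : y * x ∈ H
    · have hx1 := h.ne_zero' hx.2.2
      by_contra hc
      have hn : y * (1 + x) ∉ H := by rw [h.mul_mem_iff (h.le hx.2.2)]; exact hy.2.1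
      have hw := (h.mem_smallSet_or_inv (mul_ne_zero hy.1 hx1) hn).resolve_left hc
      have hy0 := hy.1
      -- With `w = (y(1 + x))⁻¹` small and `w * x ∉ H`, the product `w * (1 + x) = y⁻¹` would be
      -- small as well.
      have hwx : (y * (1 + x))⁻¹ * x ∉ H := by
        intro hcc
        apply hx.2.1
        apply hsq
        have : x ^ 2 = (y * (1 + x))⁻¹ * x * (y * x) * (1 + x) := by field_simp
        rw [this]
        exact H.mul_mem (H.mul_mem hcc hxy) (h.le hx.2.2)
      have := h.mul_one_add_mem hw hx hwx
      have e : (y * (1 + x))⁻¹ * (1 + x) = y⁻¹ := by field_simp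
      rw [e] at this
      exact h.inv_notMem_smallSet hy this
    · exact h.mul_one_add_mem hy hx hxy

end RigidPair

end RigidPair

/-! ### The case of exponent two -/

section ExponentTwo

variable {K : Type*} [Field K]

/-- The monoid generated by the small elements `x` in the class of `e` and the `(1 + x) ^ ±1`. -/
def classMonoid (T : Submonoid K) (e : K) : Submonoid K :=
  Submonoid.closure {p | ∃ x ∈ smallSet T T, x * e ∈ T ∧ (p = x ∨ p = 1 + x ∨ p = (1 + x)⁻¹)}

namespace RigidPair

variable {T : Submonoid K} (h : RigidPair T T) (hsq : ∀ x : K, x ≠ 0 → x ^ 2 ∈ T)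
include h

lemma mul_one_add_inv_mem {x y : K} (hx : x ∈ smallSet T T) (hy : y ∈ smallSet T T)
    (hxy : x * y ∉ T) : x * (1 + y)⁻¹ ∈ smallSet T T := by
  have hy1 := h.ne_zero' hy.2.2
  have := h.mul_one_add_mem hx (h.neg_div_one_add_mem hy) (by
    rw [← mul_div_assoc, h.div_mem_iff hy.2.2, mul_neg, h.neg_mem_iff]
    exact hxy)
  have e : 1 + -y / (1 + y) = (1 + y)⁻¹ := by field_simp; ring
  rwa [e] at this

include hsq

/-- Write `xy = (xy/(1 + x)) * (1 + x)`. Because squares lie in `T`, `xy/(1 + x)` times `x` is in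
the class of `y`, so `mul_one_add_mem` applies. -/
lemma mul_mem_smallSet {x y : K} (hx : x ∈ smallSet T T) (hy : y ∈ smallSet T T)
    (hxy : x * y ∉ T) : x * y ∈ smallSet T T := by
  have hx1 := h.ne_zero' hx.2.2
  have h1 := h.mul_one_add_mem (h.mul_div_one_add_mem hx hy hxy) hx (by
    have e : x * y / (1 + x) * x = x ^ 2 / (1 + x) * y := by ring
    rw [e, h.mul_mem_iff' (h.divT (hsq x hx.1) hx.2.2)]
    exact hy.2.1)
  have e : x * y / (1 + x) * (1 + x) = x * y := by field_simp
  rwa [e] at h1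

lemma trans_class {x y z : K} (hy0 : y ≠ 0) (hxy : x * y ∈ T) (hyz : y * z ∈ T) : x * z ∈ T := by
  have := h.divT (T.mul_mem hxy hyz) (hsq y hy0)
  have e : x * y * (y * z) / y ^ 2 = x * z := by field_simp
  rwa [e] at this

/-- In exponent two, `a * e ∉ T` says that `a` and `e` lie in different classes. Multiplying by a
generator `x` moves the class of `a` to that of `a * e`, which is still not the class of `e` since
`a ∉ T`; the induction can continue. -/
lemma mul_classMonoid {a e p : K} (ha : a ∈ smallSet T T) (hae : a * e ∉ T)
    (hp : p ∈ classMonoid T e) : a * p ∈ smallSet T T ∧ a * p * e ∉ T := by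
  induction hp using Submonoid.closure_induction generalizing a with
  | mem p hp =>
    obtain ⟨x, hx, hxe, hpx⟩ := hp
    have hax : a * x ∉ T := fun hc => hae (h.trans_class hsq hx.1 hc hxe)
    rcases hpx with rfl | rfl | rfl
    · refine ⟨h.mul_mem_smallSet hsq ha hx hax, ?_⟩
      rw [mul_assoc, h.mul_mem_iff hxe]
      exact ha.2.1
    · refine ⟨h.mul_one_add_mem ha hx hax, ?_⟩
      rw [mul_right_comm, h.mul_mem_iff hx.2.2]
      exact hae
    · refine ⟨h.mul_one_add_inv_mem ha hx hax, ?_⟩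
      rw [mul_right_comm, h.mul_mem_iff (h.invT _ hx.2.2)]
      exact hae
  | one => simpa using ⟨ha, hae⟩
  | mul p q _ _ hp hq =>
    obtain ⟨h1, h2⟩ := hp ha hae
    rw [← mul_assoc]
    exact hq h1 h2

/-- The classes with a large element in their class monoid all coincide. -/
lemma bad_unique {e f p q : K} (hpe : p ∈ classMonoid T e) (hpe' : p * e ∈ T)
    (hp : p⁻¹ ∈ smallSet T T) (hqf : q ∈ classMonoid T f) (hqf' : q * f ∈ T)
    (hq : q⁻¹ ∈ smallSet T T) : e * f ∈ T := by
  by_contra hef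
  have he0 : e ≠ 0 := right_ne_zero_of_mul (h.ne_zero hpe')
  have hf0 : f ≠ 0 := right_ne_zero_of_mul (h.ne_zero hqf')
  have hp0 : p ≠ 0 := left_ne_zero_of_mul (h.ne_zero hpe')
  have hq0 : q ≠ 0 := left_ne_zero_of_mul (h.ne_zero hqf')
  have hinv : ∀ {x y : K}, x ≠ 0 → x * y ∈ T → x⁻¹ * y ∈ T := fun {x y} hx hxy => by
    have := h.divT hxy (hsq x hx)
    have e : x * y / x ^ 2 = x⁻¹ * y := by field_simp
    rwa [e] at this
  -- For distinct classes both `q⁻¹ * p` and `p⁻¹ * q` would be small, though they are inverse to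
  -- each other.
  have h1 := (h.mul_classMonoid hsq hq (fun hc => hef (by
    rw [mul_comm e f]
    refine h.trans_class hsq (inv_ne_zero hq0) ?_ hc
    rw [mul_comm]; exact hinv hq0 hqf')) hpe).1
  have h2 := (h.mul_classMonoid hsq hp (fun hc => hef (by
    refine h.trans_class hsq (inv_ne_zero hp0) ?_ hc
    rw [mul_comm]; exact hinv hp0 hpe')) hqf).1
  have e : p⁻¹ * q = (q⁻¹ * p)⁻¹ := by field_simp
  rw [e] at h2
  exact h.inv_notMem_smallSet h1 h2

/-- If `T` is its own rigidity subgroup and `Kˣ / T` has exponent two, then up to enlarging `T`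
by one class, `T` comes from a valuation. -/
theorem exists_valuationSubring_of_exponent_two :
    ∃ e : K, ∃ A : ValuationSubring K,
      (∀ x : K, x ≠ 0 → x ∈ A → x⁻¹ ∈ A → x ∈ T ∨ x * e ∈ T) ∧
      ∀ x ∈ A, x⁻¹ ∉ A → 1 + x ∈ T := by
  have key : ∃ e : K, e ≠ 0 ∧ ∀ f p : K, p ∈ classMonoid T f → p * f ∈ T → p⁻¹ ∈ smallSet T T →
      f * e ∈ T := by
    by_cases hbad : ∃ e p : K, p ∈ classMonoid T e ∧ p * e ∈ T ∧ p⁻¹ ∈ smallSet T T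
    · obtain ⟨e, p, hp, hpe, hps⟩ := hbad
      exact ⟨e, right_ne_zero_of_mul (h.ne_zero hpe), fun f q hq hqf hqs =>
        h.bad_unique hsq hq hqf hqs hp hpe hps⟩
    -- With no exceptional class, `e = 1` makes `H` below equal to `T`.
    · exact ⟨1, one_ne_zero, fun f p h1 h2 h3 => absurd ⟨f, p, h1, h2, h3⟩ hbad⟩
  obtain ⟨e, he0, he⟩ := key
  let H : Submonoid K :=
    { carrier := {x | x ∈ T ∨ x * e ∈ T}
      one_mem' := Or.inl T.one_mem
      mul_mem' := by
        rintro x y (hx | hx) (hy | hy)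
        · exact Or.inl (T.mul_mem hx hy)
        · exact Or.inr (by rw [mul_assoc]; exact T.mul_mem hx hy)
        · exact Or.inr (by rw [mul_right_comm]; exact T.mul_mem hx hy)
        · exact Or.inl (h.trans_class hsq he0 hx (by rwa [mul_comm])) }
  have hHmem : ∀ x, x ∈ H ↔ x ∈ T ∨ x * e ∈ T := fun x => Iff.rfl
  have hP : RigidPair T H :=
    { le := fun x hx => Or.inl hx
      zero := by
        rw [hHmem, zero_mul, or_self]
        exact h.zero
      invT := h.invT
      invH := by
        rintro x (hx | hx)
        · exact Or.inl (h.invT x hx)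
        · have hx0 : x ≠ 0 := left_ne_zero_of_mul (h.ne_zero hx)
          have := h.divT hx (hsq x hx0)
          have e' : x * e / x ^ 2 = x⁻¹ * e := by field_simp
          exact Or.inr (by rwa [e'] at this)
      neg_one := h.neg_one
      rigid := fun x hx hxH => h.rigid x hx fun hc => hxH (Or.inl hc) }
  have hST : ∀ x ∈ smallSet T H, x ∈ smallSet T T := fun x hx =>
    ⟨hx.1, fun hc => hx.2.1 (Or.inl hc), hx.2.2⟩
  have hTS : ∀ x ∈ smallSet T T, x ∉ H → x ∈ smallSet T H := fun x hx hc => ⟨hx.1, hc, hx.2.2⟩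
  have good : ∀ x, x ≠ 0 → x ∉ H → ∀ p ∈ classMonoid T x, p * x ∈ T → p ∈ smallSet T T := by
    intro x hx0 hxH p hp hpx
    have hp0 : p ≠ 0 := left_ne_zero_of_mul (h.ne_zero hpx)
    have hpT : p ∉ T := fun hc => hxH (Or.inl (by rwa [h.mul_mem_iff' hc] at hpx))
    refine (h.mem_smallSet_or_inv hp0 hpT).resolve_right fun hc => hxH (Or.inr ?_)
    exact he x p hp hpx hc
  have gen : ∀ {x y : K}, y ∈ smallSet T T → y * x ∈ T → y ∈ classMonoid T x := fun hy hyx =>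
    Submonoid.subset_closure ⟨_, hy, hyx, Or.inl rfl⟩
  have gen1 : ∀ {x y : K}, y ∈ smallSet T T → y * x ∈ T → 1 + y ∈ classMonoid T x := fun hy hyx =>
    Submonoid.subset_closure ⟨_, hy, hyx, Or.inr (Or.inl rfl)⟩
  have hself : ∀ {x : K}, x ≠ 0 → x * x ∈ T := fun {x} hx => by rw [← sq]; exact hsq x hx
  have hneg : ∀ x ∈ smallSet T H, -x ∈ smallSet T H := by
    intro x hx
    have hx' := hST x hx
    have hnH : -x ∉ H := by rw [hP.neg_mem_iff]; exact hx.2.1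
    refine hTS _ ?_ hnH
    by_contra hc
    have hnT : -x ∉ T := fun hcc => hnH (Or.inl hcc)
    have h1 := (h.mem_smallSet_or_inv (neg_ne_zero.2 hx.1) hnT).resolve_left hc
    apply hc
    have hx0 := hx.1
    refine good x hx.1 hx.2.1 _ ?_ (by rw [neg_mul, h.neg_mem_iff]; exact hself hx.1)
    -- If `-x` is not small, `(-x)⁻¹` is a small element of the class of `x`. This identity then
    -- puts `-x` in the class monoid of `x`, where `good` makes it small.
    have e1 : -x = x * (x * (-x)⁻¹) := by field_simp
    rw [e1]
    have hxP := gen hx' (hself hx.1)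
    refine Submonoid.mul_mem _ hxP (Submonoid.mul_mem _ hxP (gen h1 ?_))
    have e2 : (-x)⁻¹ * x = -1 := by field_simp
    rw [e2]; exact h.neg_one
  refine ⟨e, hP.exists_valuationSubring hneg ?_ ?_ ?_⟩
  · intro x hx y hy hxy
    exact hTS _ (h.mul_mem_smallSet hsq (hST x hx) (hST y hy) fun hc => hxy (Or.inl hc)) hxy
  · intro x hx y hy z hz hxyz
    refine hTS _ ?_ hxyz
    have hx' := hST x hx
    have hy' := hST y hy
    have hz' := hST z hz
    have hn : x * y * z ∉ T := fun hc => hxyz (Or.inl hc)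
    by_cases hxy : x * y ∈ T
    · by_cases hyz : y * z ∈ T
      · refine good x hx.1 hx.2.1 _ (Submonoid.mul_mem _ (Submonoid.mul_mem _
          (gen hx' (hself hx.1)) (gen hy' (by rwa [mul_comm]))) (gen hz' ?_)) ?_
        · rw [mul_comm]; exact h.trans_class hsq hy.1 hxy hyz
        · have e1 : x * y * z * x = x ^ 2 * (y * z) := by ring
          rw [e1]; exact T.mul_mem (hsq x hx.1) hyz
      · rw [mul_assoc] at hn ⊢
        exact h.mul_mem_smallSet hsq hx' (h.mul_mem_smallSet hsq hy' hz' hyz) hn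
    · exact h.mul_mem_smallSet hsq (h.mul_mem_smallSet hsq hx' hy' hxy) hz' hn
  · intro x hx y hy
    have hx' := hST x hx
    have hy' := hST y hy
    have hnH : y * (1 + x) ∉ H := by rw [hP.mul_mem_iff (Or.inl hx.2.2)]; exact hy.2.1
    refine hTS _ ?_ hnH
    by_cases hyx : y * x ∈ T
    · refine good x hx.1 hx.2.1 _ (Submonoid.mul_mem _ (gen hy' hyx) (gen1 hx' (hself hx.1))) ?_
      rw [mul_right_comm]
      exact T.mul_mem hyx hx.2.2
    · exact h.mul_one_add_mem hy' hx' hyx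

end RigidPair

end ExponentTwo

/-! ### Logarithmic maps, collinearity and wild elements -/

section LogMap

/-- A homomorphism from the multiplicative group of a field to an additive group that kills `-1`,
extended arbitrarily to zero. -/
structure IsLogMap {K V : Type*} [Field K] [AddCommGroup V] (φ : K → V) : Prop where
  map_mul : ∀ x y : K, x ≠ 0 → y ≠ 0 → φ (x * y) = φ x + φ y
  map_neg_one : φ (-1) = 0

/-- Two vectors are dependent. -/
def Dependent (k : Type*) {V : Type*} [Field k] [AddCommGroup V] [Module k V] (v w : V) : Prop :=
  ∃ a b : k, (a ≠ 0 ∨ b ≠ 0) ∧ a • v + b • w = 0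

variable {K k V : Type*} [Field K] [Field k] [AddCommGroup V] [Module k V]

lemma Dependent.exists_smul {v w : V} (h : Dependent k v w) (hv : v ≠ 0) : ∃ c : k, w = c • v := by
  obtain ⟨a, b, hab, e⟩ := h
  have hb : b ≠ 0 := by
    rintro rfl
    simp only [ne_eq, not_true_eq_false, or_false] at hab
    rw [zero_smul, add_zero] at e
    exact hv ((smul_eq_zero.1 e).resolve_left hab)
  refine ⟨-(b⁻¹ * a), ?_⟩
  have : w = b⁻¹ • (b • w) := by rw [smul_smul, inv_mul_cancel₀ hb, one_smul]
  rw [this, eq_neg_of_add_eq_zero_right e, smul_neg, smul_smul, neg_smul]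

namespace IsLogMap

variable {φ : K → V} (hφ : IsLogMap φ)
include hφ

lemma map_one : φ 1 = 0 := by
  have := hφ.map_mul 1 1 one_ne_zero one_ne_zero
  rw [mul_one] at this
  exact left_eq_add.1 this

lemma map_inv {x : K} (hx : x ≠ 0) : φ x⁻¹ = -φ x := by
  have := hφ.map_mul x x⁻¹ hx (inv_ne_zero hx)
  rw [mul_inv_cancel₀ hx, hφ.map_one] at this
  exact eq_neg_of_add_eq_zero_right this.symm

lemma map_div {x y : K} (hx : x ≠ 0) (hy : y ≠ 0) : φ (x / y) = φ x - φ y := by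
  rw [div_eq_mul_inv, hφ.map_mul _ _ hx (inv_ne_zero hy), hφ.map_inv hy, sub_eq_add_neg]

lemma map_neg {x : K} (hx : x ≠ 0) : φ (-x) = φ x := by
  rw [← neg_one_mul, hφ.map_mul _ _ (neg_ne_zero.2 one_ne_zero) hx, hφ.map_neg_one, zero_add]

lemma comp {W : Type*} [AddCommGroup W] [Module k W] (f : V →ₗ[k] W) :
    IsLogMap (fun x => f (φ x)) where
  map_mul x y hx hy := by rw [hφ.map_mul x y hx hy, _root_.map_add]
  map_neg_one := by rw [hφ.map_neg_one, map_zero]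

end IsLogMap

/-- Two logarithms such that the images of `u`, `v`, `u + v` in the plane are always collinear. -/
def CollinearPair (f g : K → k) : Prop :=
  ∀ u v : K, u ≠ 0 → v ≠ 0 → u + v ≠ 0 →
    (f (u + v) - f u) * (g v - g u) = (g (u + v) - g u) * (f v - f u)

/-- Dependence at `v / u` concerns `φ v - φ u` and `φ (u + v) - φ u`, the difference vectors of the
three points. -/
lemma collinearPair_of_dependent {φ : K → V} (hφ : IsLogMap φ)
    (hdep : ∀ x : K, x ≠ 0 → 1 + x ≠ 0 → Dependent k (φ x) (φ (1 + x))) (f g : V →ₗ[k] k) :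
    CollinearPair (fun x => f (φ x)) (fun x => g (φ x)) := by
  intro u v hu hv huv
  have h1 : 1 + v / u ≠ 0 := by
    intro hc
    apply huv
    have : u + v = u * (1 + v / u) := by field_simp
    rw [this, hc, mul_zero]
  obtain ⟨a, b, hab, e⟩ := hdep (v / u) (div_ne_zero hv hu) h1
  have e1 : φ (v / u) = φ v - φ u := hφ.map_div hv hu
  have e2 : φ (1 + v / u) = φ (u + v) - φ u := by
    rw [← hφ.map_div huv hu]
    congr 1
    field_simp
  rw [e1, e2] at e
  have ef := congrArg f e
  have eg := congrArg g e
  simp only [map_add, map_smul, map_sub, smul_eq_mul, map_zero] at ef eg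
  rcases hab with ha | hb
  · apply mul_left_cancel₀ ha
    linear_combination (f (φ (u + v)) - f (φ u)) * eg - (g (φ (u + v)) - g (φ u)) * ef
  · apply mul_left_cancel₀ hb
    linear_combination (g (φ v) - g (φ u)) * ef - (f (φ v) - f (φ u)) * eg

/-- The images of `r + x` and `r + x - y` are the ones predicted by a projective map. -/
lemma CollinearPair.natCast_add {f g : K → k} (hf : IsLogMap f) (hg : IsLogMap g)
    (h : CollinearPair f g) {x y : K} (hx : x ≠ 0) (hy : y ≠ 0) (hx1 : 1 + x ≠ 0)
    (hy1 : 1 + y ≠ 0) {α β : k} (hα : α ≠ 0) (hβ : β ≠ 0)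
    (hfx : f x = 1) (hgx : g x = 0) (hfy : f y = 0) (hgy : g y = 1) (hα1 : 1 + α ≠ 0)
    (hβ1 : 1 + β ≠ 0) (hfx1 : f (1 + x) = α / (1 + α)) (hgx1 : g (1 + x) = 0)
    (hfy1 : f (1 + y) = 0) (hgy1 : g (1 + y) = β / (1 + β)) (r : ℕ) :
    ((r : K) + x ≠ 0 ∧ (r : k) + α ≠ 0 ∧ f (r + x) = α / (r + α) ∧ g (r + x) = 0) ∧
    ((r : K) + x - y ≠ 0 ∧ (r : k) + α - β ≠ 0 ∧ f (r + x - y) = α / (r + α - β) ∧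
      g (r + x - y) = -β / (r + α - β)) := by
  -- The model sends `a + b x + c y` to `(α b, β c) / (a + α b + β c)`. Each new point is found as
  -- the intersection of two lines through known points, and solvability of the equations forces its
  -- denominator to be nonzero.
  have hfny : f (-y) = 0 := by rw [hf.map_neg hy, hfy]
  have hgny : g (-y) = 1 := by rw [hg.map_neg hy, hgy]
  induction r with
  | zero =>
    simp only [Nat.cast_zero, zero_add]
    refine ⟨⟨hx, hα, by rw [hfx, div_self hα], hgx⟩, ?_⟩
    have hxy : x - y ≠ 0 := by
      intro hc
      rw [sub_eq_zero.1 hc, hfy] at hfx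
      exact zero_ne_one hfx
    -- `x - y` lies on the line through `x`, `-y` and on the line through `1 + x`, `-(1 + y)`.
    have h1 := h x (-y) hx (neg_ne_zero.2 hy) (by rwa [← sub_eq_add_neg])
    have e : 1 + x + -(1 + y) = x - y := by ring
    have h2 := h (1 + x) (-(1 + y)) hx1 (neg_ne_zero.2 hy1) (by rwa [e])
    rw [e, hf.map_neg hy1, hg.map_neg hy1, hfx1, hgx1, hfy1, hgy1] at h2
    rw [← sub_eq_add_neg, hfny, hgny, hfx, hgx] at h1
    set X := f (x - y)
    set Y := g (x - y)
    have h1' : X + Y = 1 := by linear_combination h1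
    have h2' : X * (1 + α) * β + Y * (1 + β) * α = α * β := by
      field_simp at h2
      linear_combination h2
    have h3 : X * (α - β) = α := by
      linear_combination α * (1 + β) * h1' - h2'
    have hne : α - β ≠ 0 := fun hc => hα (by rw [← h3, hc, mul_zero])
    refine ⟨hxy, hne, by rw [eq_div_iff hne, h3], ?_⟩
    rw [eq_div_iff hne]
    linear_combination (α - β) * h1' - h3
  | succ r ih =>
    obtain ⟨⟨hrx, hrα, hfr, hgr⟩, hrxy, hrαβ, hfrxy, hgrxy⟩ := ih
    push_cast
    have e1 : (r : K) + 1 + x = 1 + (r + x) := by ring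
    have hrx1 : (r : K) + 1 + x ≠ 0 := by
      intro hc
      have : (r : K) + x = -1 := by linear_combination hc
      rw [this, hf.map_neg_one] at hfr
      exact div_ne_zero hα hrα hfr.symm
    have hg1 : g (r + 1 + x) = 0 := by
      have := h 1 (r + x) one_ne_zero hrx (by rwa [← e1])
      rw [← e1, hf.map_one, hg.map_one, hfr, hgr] at this
      simp only [sub_zero, mul_zero] at this
      exact (mul_eq_zero.1 this.symm).resolve_right (div_ne_zero hα hrα)
    have e2 : (r : K) + x - y + (1 + y) = r + 1 + x := by ring
    -- `r + 1 + x` lies on the line through `1`, `r + x` and on the line through `r + x - y`, `1 +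
    -- y`.
    have h2 := h (r + x - y) (1 + y) hrxy hy1 (by rwa [e2])
    rw [e2, hg1, hfrxy, hgrxy, hfy1, hgy1] at h2
    set X := f (r + 1 + x)
    have h3 : X * (r + 1 + α) = α := by
      field_simp at h2
      apply mul_left_cancel₀ (mul_ne_zero hβ hrαβ)
      linear_combination h2
    have hne : (r : k) + 1 + α ≠ 0 := fun hc => hα (by rw [← h3, hc, mul_zero])
    have hX : X = α / (r + 1 + α) := by rw [eq_div_iff hne, h3]
    refine ⟨⟨hrx1, hne, hX, hg1⟩, ?_⟩
    have hn : (r : K) + 1 + x - y ≠ 0 := by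
      intro hc
      rw [sub_eq_zero.1 hc, hgy] at hg1
      exact one_ne_zero hg1
    have e3 : 1 + ((r : K) + x - y) = r + 1 + x - y := by ring
    -- `r + 1 + x - y` lies on the line through `1`, `r + x - y` and on the line through `r + 1 +
    -- x`, `-y`.
    have h4 := h 1 (r + x - y) one_ne_zero hrxy (by rwa [e3])
    rw [e3, hf.map_one, hg.map_one, hfrxy, hgrxy] at h4
    have e4 : (r : K) + 1 + x + -y = r + 1 + x - y := by ring
    have h5 := h (r + 1 + x) (-y) hrx1 (neg_ne_zero.2 hy) (by rwa [e4])
    rw [e4, hfny, hgny, hg1] at h5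
    change (_ - X) * _ = _ * (0 - X) at h5
    rw [hX] at h5
    set Z := f (r + 1 + x - y)
    set W := g (r + 1 + x - y)
    have h4' : W * α = -Z * β := by
      field_simp at h4
      linear_combination -h4
    have h5' : Z * (r + 1 + α) + W * α = α := by
      field_simp at h5
      linear_combination h5
    have h6 : Z * (r + 1 + α - β) = α := by linear_combination h5' - h4'
    have hne' : (r : k) + 1 + α - β ≠ 0 := fun hc => hα (by rw [← h6, hc, mul_zero])
    refine ⟨hn, hne', by rw [eq_div_iff hne', h6], ?_⟩
    rw [eq_div_iff hne']
    apply mul_right_cancel₀ hα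
    linear_combination (r + 1 + α - β) * h4' - β * h6

lemma exists_dual_pair {v w : V} (h : ¬ Dependent k v w) :
    ∃ f g : V →ₗ[k] k, f v = 1 ∧ f w = 0 ∧ g v = 0 ∧ g w = 1 := by
  have aux : ∀ v w : V, ¬ Dependent k v w → ∃ f : V →ₗ[k] k, f v = 1 ∧ f w = 0 := by
    intro v w h
    have : v ∉ Submodule.span k {w} := by
      rw [Submodule.mem_span_singleton]
      rintro ⟨a, ha⟩
      exact h ⟨1, -a, Or.inl one_ne_zero, by rw [← ha]; simp⟩
    obtain ⟨f, hf, hw⟩ := Submodule.exists_le_ker_of_notMem this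
    refine ⟨(f v)⁻¹ • f, by simp [hf], ?_⟩
    have : f w = 0 := hw (Submodule.mem_span_singleton_self w)
    simp [this]
  obtain ⟨f, h1, h2⟩ := aux v w h
  obtain ⟨g, h3, h4⟩ := aux w v fun ⟨a, b, hab, e⟩ => h ⟨b, a, hab.symm, by rw [add_comm]; exact e⟩
  exact ⟨f, g, h1, h2, h4, h3⟩

section Wild

variable (φ : K → V)

/-- The elements violating the rigidity condition `1 + x ∈ T ∪ xT`, with `T` the kernel of `φ`. -/
def IsWild (x : K) : Prop := x ≠ 0 ∧ 1 + x ≠ 0 ∧ φ x ≠ 0 ∧ φ (1 + x) ≠ 0 ∧ φ (1 + x) ≠ φ x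

variable {φ} (hφ : IsLogMap φ)
  (hdep : ∀ x : K, x ≠ 0 → 1 + x ≠ 0 → Dependent k (φ x) (φ (1 + x)))
include hφ hdep

omit hφ in
lemma IsWild.exists_param {x : K} (hx : IsWild φ x) :
    ∃ α : k, α ≠ 0 ∧ 1 + α ≠ 0 ∧ φ (1 + x) = (α / (1 + α)) • φ x := by
  obtain ⟨hx0, hx1, h1, h2, h3⟩ := hx
  obtain ⟨c, hc⟩ := (hdep x hx0 hx1).exists_smul h1
  have hc0 : c ≠ 0 := by rintro rfl; exact h2 (by rw [hc, zero_smul])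
  have hc1 : 1 - c ≠ 0 := by
    intro hcc
    rw [← sub_eq_zero.1 hcc, one_smul] at hc
    exact h3 hc
  have e : 1 + c / (1 - c) = 1 / (1 - c) := by field_simp; ring
  refine ⟨c / (1 - c), div_ne_zero hc0 hc1, ?_, ?_⟩
  · rw [e]; exact div_ne_zero one_ne_zero hc1
  · rw [hc, e]
    congr 1
    field_simp

/-- The witness is `z = r + x`. Its image stays on the line of `φ x`, and the coordinate dual to `x`
reads off the factor `α / (r + α)`. The independent wild `y` is needed only to have a plane in which
to intersect lines. -/
lemma exists_smul_natCast_add {x y : K} (hx0 : x ≠ 0) (hx1 : 1 + x ≠ 0) (hy : IsWild φ y)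
    (hxy : ¬ Dependent k (φ x) (φ y)) {α : k} (hα : α ≠ 0) (hα1 : 1 + α ≠ 0)
    (hxα : φ (1 + x) = (α / (1 + α)) • φ x) (r : ℕ) :
    ∃ z : K, z ≠ 0 ∧ ((r : k) + α) • φ z = α • φ x := by
  obtain ⟨β, hβ, hβ1, hyβ⟩ := hy.exists_param hdep
  obtain ⟨f, g, hfx, hfy, hgx, hgy⟩ := exists_dual_pair hxy
  have key := fun r => CollinearPair.natCast_add (hφ.comp f) (hφ.comp g)
    (collinearPair_of_dependent hφ hdep f g) hx0 hy.1 hx1 hy.2.1 hα hβ hfx hgx hfy hgy hα1 hβ1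
    (by simp [hxα, hfx]) (by simp [hxα, hgx]) (by simp [hyβ, hfy]) (by simp [hyβ, hgy]) r
  have hsm : ∀ r : ℕ, ∃ c : k, φ (r + x) = c • φ x := by
    intro r
    induction r with
    | zero => exact ⟨1, by simp⟩
    | succ r ih =>
      obtain ⟨c, hc⟩ := ih
      obtain ⟨⟨h1, h2, h3, -⟩, -⟩ := key r
      obtain ⟨⟨h4, -⟩, -⟩ := key (r + 1)
      have e : ((r + 1 : ℕ) : K) + x = 1 + (r + x) := by push_cast; ring
      rw [e] at h4
      obtain ⟨d, hd⟩ := (hdep (r + x) h1 h4).exists_smul (by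
        intro hcc
        rw [hcc, map_zero] at h3
        exact div_ne_zero hα h2 h3.symm)
      exact ⟨d * c, by rw [e, hd, hc, smul_smul]⟩
  obtain ⟨⟨h1, h2, h3, -⟩, -⟩ := key r
  obtain ⟨c, hc⟩ := hsm r
  refine ⟨r + x, h1, ?_⟩
  rw [hc, map_smul, hfx, smul_eq_mul, mul_one] at h3
  rw [hc, smul_smul, h3, mul_div_cancel₀ _ h2]

lemma IsWild.dependent
    (harch : ∀ α : k, α ≠ 0 → ∀ x : K, x ≠ 0 →
      (∀ r : ℕ, ∃ z : K, z ≠ 0 ∧ ((r : k) + α) • φ z = α • φ x) →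
      (∀ r : ℕ, ∃ z : K, z ≠ 0 ∧ ((r : k) + α⁻¹) • φ z = α⁻¹ • φ x) → φ x = 0)
    {x y : K} (hx : IsWild φ x) (hy : IsWild φ y) : Dependent k (φ x) (φ y) := by
  by_contra hxy
  obtain ⟨α, hα, hα1, hxα⟩ := hx.exists_param hdep
  have hx0 := hx.1
  have hx1 := hx.2.1
  refine hx.2.2.1 (harch α hα x hx0
    (exists_smul_natCast_add hφ hdep hx0 hx1 hy hxy hα hα1 hxα) fun r => ?_)
  have e1 : 1 + x⁻¹ = (1 + x) / x := by field_simp; ring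
  -- The parameter of `x⁻¹` is `α⁻¹`, because `1 + x⁻¹ = (1 + x) / x`. Both parameters are supplied
  -- since over `ℤ_ℓ` only one of them need be integral.
  obtain ⟨z, hz, h⟩ := exists_smul_natCast_add hφ hdep (x := x⁻¹) (inv_ne_zero hx0)
    (by rw [e1]; exact div_ne_zero hx1 hx0) hy
    (fun ⟨a, b, hab, e⟩ => hxy ⟨-a, b, hab.imp_left neg_ne_zero.2, by
      rw [← e, hφ.map_inv hx0, smul_neg, neg_smul]⟩) (inv_ne_zero hα)
    (by
      have : 1 + α⁻¹ = (1 + α) / α := by field_simp; ring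
      rw [this]; exact div_ne_zero hα1 hα)
    (by
      rw [e1, hφ.map_div hx1 hx0, hφ.map_inv hx0, hxα, smul_neg, ← neg_smul]
      nth_rewrite 2 [← one_smul k (φ x)]
      rw [← sub_smul]
      congr 1
      have : α + 1 ≠ 0 := by rwa [add_comm]
      field_simp
      ring) r
  refine ⟨z⁻¹, inv_ne_zero hz, ?_⟩
  rw [hφ.map_inv hz, smul_neg, h, hφ.map_inv hx0, smul_neg, neg_neg]

/-- A logarithm with `φ x` and `φ (1 - x)` always dependent comes from a valuation. -/
theorem exists_valuationSubring_of_dependent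
    (harch : ∀ α : k, α ≠ 0 → ∀ x : K, x ≠ 0 →
      (∀ r : ℕ, ∃ z : K, z ≠ 0 ∧ ((r : k) + α) • φ z = α • φ x) →
      (∀ r : ℕ, ∃ z : K, z ≠ 0 ∧ ((r : k) + α⁻¹) • φ z = α⁻¹ • φ x) → φ x = 0)
    (hk : (2 : k) ≠ 0 ∨ ∀ c : k, c = 0 ∨ c = 1) :
    ∃ A : ValuationSubring K, (∀ x ∈ A, x⁻¹ ∉ A → φ (1 + x) = 0) ∧
      ∃ v : V, ∀ x : K, x ≠ 0 → x ∈ A → x⁻¹ ∈ A → ∃ c : k, φ x = c • v := by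
  let T : Submonoid K :=
    { carrier := {x | x ≠ 0 ∧ φ x = 0}
      one_mem' := ⟨one_ne_zero, hφ.map_one⟩
      mul_mem' := fun {x y} hx hy => ⟨mul_ne_zero hx.1 hy.1, by
        rw [hφ.map_mul x y hx.1 hy.1, hx.2, hy.2, add_zero]⟩ }
  have hT : ∀ x, x ∈ T ↔ x ≠ 0 ∧ φ x = 0 := fun x => Iff.rfl
  have hTinv : ∀ x ∈ T, x⁻¹ ∈ T := fun x hx =>
    ⟨inv_ne_zero hx.1, by rw [hφ.map_inv hx.1, hx.2, neg_zero]⟩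
  have hTneg : (-1 : K) ∈ T := ⟨neg_ne_zero.2 one_ne_zero, hφ.map_neg_one⟩
  have hrig : ∀ x : K, x ≠ 0 → x ∉ T → ¬ IsWild φ x → 1 + x ∈ T ∨ ∃ t ∈ T, 1 + x = t * x := by
    intro x hx0 hxT hw
    have hx : φ x ≠ 0 := fun hc => hxT ⟨hx0, hc⟩
    have hx1 : 1 + x ≠ 0 := by
      intro hc
      rw [← neg_eq_iff_add_eq_zero.2 hc, hφ.map_neg_one] at hx
      exact hx rfl
    by_cases h1 : φ (1 + x) = 0
    · exact Or.inl ⟨hx1, h1⟩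
    · have h2 : φ (1 + x) = φ x := by
        by_contra h2
        exact hw ⟨hx0, hx1, hx, h1, h2⟩
      refine Or.inr ⟨(1 + x) / x, ⟨div_ne_zero hx1 hx0, by rw [hφ.map_div hx1 hx0, h2, sub_self]⟩, ?_⟩
      field_simp
  rcases hk with h2 | hk
  · have hv : ∃ v : V, ∀ x, IsWild φ x → ∃ c : k, φ x = c • v := by
      by_cases hw : ∃ y, IsWild φ y
      · obtain ⟨y, hy⟩ := hw
        exact ⟨φ y, fun x hx => (hy.dependent hφ hdep harch hx).exists_smul hy.2.2.1⟩
      · exact ⟨0, fun x hx => absurd ⟨x, hx⟩ hw⟩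
    obtain ⟨v, hv⟩ := hv
    let H : Submonoid K :=
      { carrier := {x | x ≠ 0 ∧ ∃ c : k, φ x = c • v}
        one_mem' := ⟨one_ne_zero, 0, by rw [hφ.map_one, zero_smul]⟩
        mul_mem' := by
          rintro x y ⟨hx, c, hc⟩ ⟨hy, d, hd⟩
          exact ⟨mul_ne_zero hx hy, c + d, by rw [hφ.map_mul x y hx hy, hc, hd, add_smul]⟩ }
    have hP : RigidPair T H :=
      { le := fun x hx => ⟨hx.1, 0, by rw [hx.2, zero_smul]⟩
        zero := fun hc => hc.1 rfl
        invT := hTinv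
        invH := fun x ⟨hx, c, hc⟩ =>
          ⟨inv_ne_zero hx, -c, by rw [hφ.map_inv hx, hc, neg_smul]⟩
        neg_one := hTneg
        rigid := fun x hx hxH => hrig x hx
          (fun hc => hxH ⟨hc.1, 0, by rw [hc.2, zero_smul]⟩) fun hw => hxH ⟨hx, hv x hw⟩ }
    -- `H` is the preimage of the line `k v`; the quotient `V / k v` is a vector space over a field
    -- with `2 ≠ 0`, hence without `2`-torsion.
    obtain ⟨A, hA1, hA2⟩ := hP.exists_valuationSubring_of_sq (by
      rintro x ⟨hx2, c, hc⟩
      have hx : x ≠ 0 := fun h0 => hx2 (by rw [h0]; ring)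
      refine ⟨hx, c / 2, ?_⟩
      rw [sq, hφ.map_mul x x hx hx, ← two_smul k] at hc
      rw [div_eq_inv_mul, mul_smul, ← hc, smul_smul, inv_mul_cancel₀ h2, one_smul])
    exact ⟨A, fun x h1 h3 => (hA2 x h1 h3).2, v, fun x h0 h1 h3 => (hA1 x h0 h1 h3).2⟩
  · have h2 : (2 : k) = 0 := by
      rcases hk 2 with h | h
      · exact h
      · exfalso
        have : (1 : k) + 1 = 1 := by rw [one_add_one_eq_two]; exact h
        exact one_ne_zero (add_eq_left.1 this)
    have hP : RigidPair T T :=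
      { le := le_rfl
        zero := fun hc => hc.1 rfl
        invT := hTinv
        invH := hTinv
        neg_one := hTneg
        -- Over a field with two elements, dependent vectors are zero or equal, so nothing is wild.
        rigid := fun x hx hxT => hrig x hx hxT fun ⟨_, hx1, hw1, hw2, hw3⟩ => by
          obtain ⟨c, hc⟩ := (hdep x hx hx1).exists_smul hw1
          rcases hk c with rfl | rfl
          · exact hw2 (by rw [hc, zero_smul])
          · exact hw3 (by rw [hc, one_smul]) }
    obtain ⟨e, A, hA1, hA2⟩ := hP.exists_valuationSubring_of_exponent_two (fun x hx =>
      ⟨pow_ne_zero 2 hx, by rw [sq, hφ.map_mul x x hx hx, ← two_smul k, h2, zero_smul]⟩)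
    refine ⟨A, fun x h1 h3 => (hA2 x h1 h3).2, φ e, fun x h0 h1 h3 => ?_⟩
    rcases hA1 x h0 h1 h3 with h4 | h4
    · exact ⟨0, by rw [h4.2, zero_smul]⟩
    · have he : e ≠ 0 := right_ne_zero_of_mul h4.1
      refine ⟨-1, ?_⟩
      have := h4.2
      rw [hφ.map_mul x e h0 he] at this
      rw [neg_one_smul]
      exact eq_neg_of_add_eq_zero_left this

end Wild

end LogMap

/-! ### Composites of valuation rings and the coarsest valuation -/

section Canonical

variable {K : Type*} [Field K]

lemma mem_unitGroup_iff_mem (A : ValuationSubring K) (u : Kˣ) :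
    u ∈ A.unitGroup ↔ (u : K) ∈ A ∧ (u : K)⁻¹ ∈ A := by
  rw [A.mem_unitGroup_iff, ← A.valuation_le_one_iff, ← A.valuation_le_one_iff, map_inv₀]
  constructor
  · intro h; simp [h]
  · rintro ⟨h1, h2⟩
    refine le_antisymm h1 ?_
    have h0 : A.valuation (u : K) ≠ 0 := by simp
    exact (inv_le_one₀ (zero_lt_iff.2 h0)).1 h2

lemma mem_principalUnitGroup_iff_mem (A : ValuationSubring K) (u : Kˣ) :
    u ∈ A.principalUnitGroup ↔ (u : K) - 1 = 0 ∨ ((u : K) - 1)⁻¹ ∉ A := by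
  rw [A.mem_principalUnitGroup_iff, ← A.mem_nonunits_iff, A.mem_nonunits_iff_or]

lemma mem_of_inv_notMem {A : ValuationSubring K} {x : K} (h : x⁻¹ ∉ A) : x ∈ A :=
  (A.mem_or_inv_mem x).resolve_right h

/-- The products `a * b` with `a ∈ A` and `b ∈ B` form a valuation ring. -/
def prodRing (A B : ValuationSubring K) : ValuationSubring K :=
  -- A sum becomes a product by cases: if `c ∉ B` then `c⁻¹ ∈ B`, and `c` can be factored out,
  -- leaving a cofactor in `B`.
  have hA : ∀ a ∈ A, ∀ b ∈ B, ∃ a' ∈ A, ∃ b' ∈ B, a + b = a' * b' := by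
    intro c hc d hd
    by_cases hcB : c ∈ B
    · exact ⟨1, A.one_mem, c + d, B.add_mem _ _ hcB hd, by ring⟩
    have hc' : c⁻¹ ∈ B := (B.mem_or_inv_mem c).resolve_left hcB
    have hc0 : c ≠ 0 := by rintro rfl; exact hcB B.zero_mem
    exact ⟨c, hc, 1 + c⁻¹ * d, B.add_mem _ _ B.one_mem (B.mul_mem _ _ hc' hd), by field_simp⟩
  have hM : ∀ c ∈ A, ∀ d ∈ B, ∃ a' ∈ A, ∃ b' ∈ B, 1 + c * d = a' * b' := by
    intro c hc d hd
    by_cases hcB : c ∈ B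
    · exact ⟨1, A.one_mem, 1 + c * d, B.add_mem _ _ B.one_mem (B.mul_mem _ _ hcB hd), by ring⟩
    have hc' : c⁻¹ ∈ B := (B.mem_or_inv_mem c).resolve_left hcB
    have hc0 : c ≠ 0 := by rintro rfl; exact hcB B.zero_mem
    exact ⟨c, hc, c⁻¹ + d, B.add_mem _ _ hc' hd, by field_simp⟩
  { carrier := {x | ∃ a ∈ A, ∃ b ∈ B, x = a * b}
    mul_mem' := by
      rintro _ _ ⟨a, ha, b, hb, rfl⟩ ⟨c, hc, d, hd, rfl⟩
      exact ⟨a * c, A.mul_mem _ _ ha hc, b * d, B.mul_mem _ _ hb hd, by ring⟩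
    one_mem' := ⟨1, A.one_mem, 1, B.one_mem, by ring⟩
    zero_mem' := ⟨0, A.zero_mem, 0, B.zero_mem, by ring⟩
    neg_mem' := by
      rintro _ ⟨a, ha, b, hb, rfl⟩
      exact ⟨-a, A.neg_mem _ ha, b, hb, by ring⟩
    add_mem' := by
      have main : ∀ a ∈ A, ∀ b ∈ B, ∀ c ∈ A, ∀ d ∈ B, a ≠ 0 → c / a ∈ A →
          ∃ a' ∈ A, ∃ b' ∈ B, a * b + c * d = a' * b' := by
        intro a ha b hb c hc d hd ha0 hca
        by_cases hb0 : b = 0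
        · exact ⟨c, hc, d, hd, by rw [hb0]; ring⟩
        rcases B.mem_or_inv_mem (d / b) with h | h
        · obtain ⟨a', ha', b', hb', e⟩ := hM _ hca _ h
          refine ⟨a * a', A.mul_mem _ _ ha ha', b * b', B.mul_mem _ _ hb hb', ?_⟩
          have : a * b + c * d = a * b * (1 + c / a * (d / b)) := by field_simp
          rw [this, e]; ring
        · by_cases hd0 : d = 0
          · exact ⟨a, ha, b, hb, by rw [hd0]; ring⟩
          obtain ⟨a', ha', b', hb', e⟩ := hA _ hca _ h
          refine ⟨a * a', A.mul_mem _ _ ha ha', d * b', B.mul_mem _ _ hd hb', ?_⟩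
          have : a * b + c * d = a * d * (c / a + (d / b)⁻¹) := by field_simp; ring
          rw [this, e]; ring
      rintro _ _ ⟨a, ha, b, hb, rfl⟩ ⟨c, hc, d, hd, rfl⟩
      by_cases ha0 : a = 0
      · exact ⟨c, hc, d, hd, by rw [ha0]; ring⟩
      by_cases hc0 : c = 0
      · exact ⟨a, ha, b, hb, by rw [hc0]; ring⟩
      rcases A.mem_or_inv_mem (c / a) with h | h
      · exact main a ha b hb c hc d hd ha0 h
      · rw [inv_div] at h
        rw [add_comm]
        exact main c hc d hd a ha b hb hc0 h
    mem_or_inv_mem' := fun x => by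
      rcases A.mem_or_inv_mem x with h | h
      · exact Or.inl ⟨x, h, 1, B.one_mem, by ring⟩
      · exact Or.inr ⟨x⁻¹, h, 1, B.one_mem, by ring⟩ }

lemma le_prodRing_left (A B : ValuationSubring K) : A ≤ prodRing A B := fun x hx =>
  ⟨x, hx, 1, B.one_mem, by ring⟩

lemma le_prodRing_right (A B : ValuationSubring K) : B ≤ prodRing A B := fun x hx =>
  ⟨1, A.one_mem, x, hx, by ring⟩

/-- The key identity is `z = (1 + z) * (1 + z⁻¹)⁻¹`. For `z` in the maximal ideal of `A` but outside
`B`, the first factor is a unit of `A` and the second a unit of `B`. -/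
lemma exists_unit_mul_unit_of_notMem {A B : ValuationSubring K} {x : K} (hx : x ∈ prodRing A B)
    (hxB : x ∉ B) :
    ∃ a b : K, a ≠ 0 ∧ b ≠ 0 ∧ a ∈ A ∧ a⁻¹ ∈ A ∧ b ∈ B ∧ b⁻¹ ∈ B ∧ x = a * b := by
  have hu : ∀ (C : ValuationSubring K) (z : K), z⁻¹ ∉ C →
      1 + z ≠ 0 ∧ 1 + z ∈ C ∧ (1 + z)⁻¹ ∈ C := by
    intro C z hz
    have hzC := mem_of_inv_notMem hz
    have h1 : 1 + z ≠ 0 := by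
      intro hc
      apply hz
      rw [← neg_eq_iff_add_eq_zero.2 hc, inv_neg, inv_one]
      exact C.neg_mem _ C.one_mem
    refine ⟨h1, C.add_mem _ _ C.one_mem hzC, ?_⟩
    by_contra hc
    apply hz
    have hz0 : z ≠ 0 := by rintro rfl; simp [C.zero_mem] at hz
    rcases C.mem_or_inv_mem (z / (1 + z)) with h | h
    · exfalso
      apply hc
      have : (1 + z)⁻¹ = 1 - z / (1 + z) := by field_simp; ring
      rw [this, sub_eq_add_neg]
      exact C.add_mem _ _ C.one_mem (C.neg_mem _ h)
    · have : z⁻¹ = (z / (1 + z))⁻¹ - 1 := by field_simp; ring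
      rw [this, sub_eq_add_neg]
      exact C.add_mem _ _ h (C.neg_mem _ C.one_mem)
  -- an element of `A` that is not in `B` can be replaced by a unit of `A`
  have step : ∀ z : K, z ∈ A → z ∉ B →
      ∃ a b : K, a ≠ 0 ∧ b ≠ 0 ∧ a ∈ A ∧ a⁻¹ ∈ A ∧ b ∈ B ∧ b⁻¹ ∈ B ∧ z = a * b := by
    intro z hzA hzB
    have hz0 : z ≠ 0 := by rintro rfl; exact hzB B.zero_mem
    by_cases hzi : z⁻¹ ∈ A
    · exact ⟨z, 1, hz0, one_ne_zero, hzA, hzi, B.one_mem, by simp [B.one_mem], by ring⟩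
    · obtain ⟨h1, h2, h3⟩ := hu A z hzi
      obtain ⟨h4, h5, h6⟩ := hu B z⁻¹ (by rwa [inv_inv])
      have e : 1 + z⁻¹ = (1 + z) / z := by field_simp; ring
      refine ⟨1 + z, (1 + z⁻¹)⁻¹, h1, inv_ne_zero h4, h2, h3, h6, by rwa [inv_inv], ?_⟩
      rw [e]; field_simp
  obtain ⟨a, ha, b, hb, rfl⟩ := hx
  by_cases hbA : b ∈ A
  · exact step _ (A.mul_mem _ _ ha hbA) hxB
  have hb0 : b ≠ 0 := by rintro rfl; exact hbA A.zero_mem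
  have haB : a ∉ B := fun hc => hxB (B.mul_mem _ _ hc hb)
  by_cases hbi : b⁻¹ ∈ B
  · obtain ⟨c, d, hc0, hd0, hc, hc', hd, hd', e⟩ := step a ha haB
    refine ⟨c, d * b, hc0, mul_ne_zero hd0 hb0, hc, hc', B.mul_mem _ _ hd hb, ?_, by rw [e]; ring⟩
    rw [mul_inv]; exact B.mul_mem _ _ hd' hbi
  · obtain ⟨h1, h2, h3⟩ := hu B b hbi
    obtain ⟨h4, h5, h6⟩ := hu A b⁻¹ (by rwa [inv_inv])
    have e : 1 + b⁻¹ = (1 + b) / b := by field_simp; ring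
    have hu' : b / (1 + b) = (1 + b⁻¹)⁻¹ := by rw [e, inv_div]
    have h7 : a * (b / (1 + b)) ∈ A := by rw [hu']; exact A.mul_mem _ _ ha h6
    have h8 : a * (b / (1 + b)) ∉ B := by
      intro hc
      apply hxB
      have := B.mul_mem _ _ hc h2
      have e' : a * (b / (1 + b)) * (1 + b) = a * b := by field_simp
      rwa [e'] at this
    obtain ⟨c, d, hc0, hd0, hc, hc', hd, hd', e2⟩ := step _ h7 h8
    refine ⟨c, d * (1 + b), hc0, mul_ne_zero hd0 h1, hc, hc', B.mul_mem _ _ hd h2, ?_, ?_⟩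
    · rw [mul_inv]; exact B.mul_mem _ _ hd' h3
    · rw [← mul_assoc, ← e2]; field_simp

lemma exists_unit_mul_unit {A B : ValuationSubring K} {x : K} (hx0 : x ≠ 0)
    (hx : x ∈ prodRing A B) (hxi : x⁻¹ ∈ prodRing A B) :
    ∃ a b : K, a ≠ 0 ∧ b ≠ 0 ∧ a ∈ A ∧ a⁻¹ ∈ A ∧ b ∈ B ∧ b⁻¹ ∈ B ∧ x = a * b := by
  by_cases h1 : x ∈ B
  · by_cases h2 : x⁻¹ ∈ B
    · exact ⟨1, x, one_ne_zero, hx0, A.one_mem, by simp [A.one_mem], h1, h2, by ring⟩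
    · obtain ⟨a, b, ha0, hb0, ha, ha', hb, hb', e⟩ := exists_unit_mul_unit_of_notMem hxi h2
      exact ⟨a⁻¹, b⁻¹, inv_ne_zero ha0, inv_ne_zero hb0, ha', by rwa [inv_inv], hb',
        by rwa [inv_inv], by rw [← inv_inv x, e, mul_inv]⟩
  · exact exists_unit_mul_unit_of_notMem hx h1

lemma prodRing_unitGroup_le {A B : ValuationSubring K} {H : Subgroup Kˣ} (hA : A.unitGroup ≤ H)
    (hB : B.unitGroup ≤ H) : (prodRing A B).unitGroup ≤ H := by
  intro u hu
  rw [mem_unitGroup_iff_mem] at hu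
  obtain ⟨a, b, ha0, hb0, ha, ha', hb, hb', e⟩ := exists_unit_mul_unit u.ne_zero hu.1 hu.2
  have : u = Units.mk0 a ha0 * Units.mk0 b hb0 := by ext; simpa using e
  rw [this]
  exact H.mul_mem (hA ((mem_unitGroup_iff_mem _ _).2 ⟨ha, ha'⟩))
    (hB ((mem_unitGroup_iff_mem _ _).2 ⟨hb, hb'⟩))

/-- A valuative subgroup has a canonical valuation. -/
theorem IsValuative.exists_isCanonicalValuation {H : Subgroup Kˣ} (hH : IsValuative H) :
    ∃ A : ValuationSubring K, IsCanonicalValuation A H := by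
  obtain ⟨A₀, hA₀⟩ := hH
  -- The union of all admissible rings is a ring because `prodRing` makes the family directed.
  let A : ValuationSubring K :=
    { carrier := {x | ∃ B : ValuationSubring K, B.unitGroup ≤ H ∧ x ∈ B}
      mul_mem' := by
        rintro x y ⟨B, hB, hx⟩ ⟨C, hC, hy⟩
        exact ⟨_, prodRing_unitGroup_le hB hC, mul_mem (le_prodRing_left B C hx)
          (le_prodRing_right B C hy)⟩
      add_mem' := by
        rintro x y ⟨B, hB, hx⟩ ⟨C, hC, hy⟩
        exact ⟨_, prodRing_unitGroup_le hB hC, add_mem (le_prodRing_left B C hx)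
          (le_prodRing_right B C hy)⟩
      neg_mem' := by
        rintro x ⟨B, hB, hx⟩
        exact ⟨B, hB, neg_mem hx⟩
      one_mem' := ⟨A₀, hA₀, A₀.one_mem⟩
      zero_mem' := ⟨A₀, hA₀, A₀.zero_mem⟩
      mem_or_inv_mem' := fun x => by
        rcases A₀.mem_or_inv_mem x with h | h
        · exact Or.inl ⟨A₀, hA₀, h⟩
        · exact Or.inr ⟨A₀, hA₀, h⟩ }
  refine ⟨A, fun u hu => ?_, fun B hB x hx => ⟨B, hB, hx⟩⟩
  rw [mem_unitGroup_iff_mem] at hu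
  obtain ⟨⟨B, hB, hx⟩, C, hC, hy⟩ := hu
  exact prodRing_unitGroup_le hB hC ((mem_unitGroup_iff_mem _ _).2
    ⟨le_prodRing_left B C hx, le_prodRing_right B C hy⟩)

lemma ringChar_residueField_ne {A : ValuationSubring K} {ℓ : ℕ} (hℓ : (ℓ : K) ≠ 0)
    (h : (ℓ : K)⁻¹ ∈ A) : ringChar (IsLocalRing.ResidueField A) ≠ ℓ := by
  rintro e
  have h0 : ((ℓ : A) : K) = (ℓ : K) := by simp
  have hu : IsUnit (ℓ : A) := by
    refine IsUnit.of_mul_eq_one ⟨(ℓ : K)⁻¹, h⟩ ?_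
    apply Subtype.ext
    push_cast
    exact mul_inv_cancel₀ hℓ
  have := hu.map (IsLocalRing.residue A)
  rw [map_natCast, ← e, ringChar.Nat.cast_ringChar] at this
  exact not_isUnit_zero this

end Canonical

/-! ### Residue characteristic `ℓ`: extracting roots and inverting `ℓ` -/

section Descent

variable {L V : Type*} [Field L] [AddCommGroup V] {φ : L → V} (hφ : IsLogMap φ)
  {A : ValuationSubring L} {ℓ : ℕ} (hℓ : ℓ.Prime)

lemma IsLogMap.map_pow (hφ : IsLogMap φ) {x : L} (hx : x ≠ 0) (n : ℕ) : φ (x ^ n) = n • φ x := by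
  induction n with
  | zero => rw [pow_zero, hφ.map_one, zero_smul]
  | succ n ih => rw [pow_succ, hφ.map_mul _ _ (pow_ne_zero n hx) hx, ih, succ_nsmul]

lemma valuation_lt_one_iff_inv {x : L} : A.valuation x < 1 ↔ x = 0 ∨ x⁻¹ ∉ A := by
  rw [← A.mem_nonunits_iff, A.mem_nonunits_iff_or]

variable (hA : ∀ x : L, A.valuation x < 1 → φ (1 + x) = 0) (hℓ0 : (ℓ : L) ≠ 0)
  (hℓA : A.valuation (ℓ : L) < 1)

include hφ hℓ hA hℓ0 hℓA

/-- The `ℓ`-th roots of principal units `1 + b` with `b` of value at most that of `ℓ`. -/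
lemma map_eq_nsmul_of_root {b c : L} (hb0 : b ≠ 0) (hb : A.valuation b < 1)
    (hℓb : A.valuation (ℓ : L) ≤ A.valuation b) (h : (1 + c) ^ ℓ = 1 + b) :
    c ≠ 0 ∧ A.valuation c < 1 ∧ A.valuation (ℓ : L) ≤ A.valuation c ∧ φ b = ℓ • φ c := by
  have hc0 : c ≠ 0 := by
    rintro rfl
    rw [add_zero, one_pow] at h
    exact hb0 (left_eq_add.1 h)
  have hb1 : A.valuation (1 + b) ≤ 1 :=
    (A.valuation.map_add _ _).trans (max_le (by simp) hb.le)
  have hcA : c ∈ A := by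
    have h1 : A.valuation (1 + c) ≤ 1 := by
      rw [← h, map_pow] at hb1
      exact (pow_le_one_iff hℓ.ne_zero).1 hb1
    rw [A.valuation_le_one_iff] at h1
    have := A.add_mem _ _ h1 (A.neg_mem _ A.one_mem)
    have e : 1 + c + -1 = c := by ring
    rwa [e] at this
  -- The middle binomial coefficients are divisible by `ℓ`, so `b = c ^ ℓ + ℓ c s` with `s`
  -- integral.
  obtain ⟨s, hs⟩ := exists_add_pow_prime_eq hℓ (1 : A) ⟨c, hcA⟩
  have hs' := congrArg (Subtype.val : A → L) hs
  push_cast at hs'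
  have hsv : A.valuation (s : L) ≤ 1 := A.valuation_le_one s
  rw [h] at hs'
  have eb : b = c ^ ℓ + ℓ * c * s := by linear_combination hs'
  have hcv : A.valuation c ≤ 1 := (A.valuation_le_one_iff c).2 hcA
  have hvl : 0 < A.valuation (ℓ : L) := zero_lt_iff.2 (by simpa using hℓ0)
  have hls : A.valuation (ℓ * c * s) ≤ A.valuation (ℓ : L) * A.valuation c := by
    rw [map_mul, map_mul]
    exact mul_le_of_le_one_right' hsv
  have hc1 : A.valuation c < 1 := by
    have e1 : c ^ ℓ = b - ℓ * c * s := by rw [eb]; ring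
    have : A.valuation (c ^ ℓ) < 1 := by
      rw [e1]
      refine (A.valuation.map_sub _ _).trans_lt (max_lt hb (hls.trans_lt ?_))
      exact (mul_le_of_le_one_right' hcv).trans_lt hℓA
    rw [map_pow] at this
    by_contra hc
    exact this.not_ge (one_le_pow_of_one_le' (not_lt.1 hc) ℓ)
  have hℓ1 : ℓ = (ℓ - 1) + 1 := (Nat.sub_add_cancel hℓ.one_lt.le).symm
  -- Otherwise both terms of `b` have value at most that of `ℓ c`, which is below that of `ℓ`. Hence
  -- `c ^ ℓ` dominates and `b` is `c ^ ℓ` times a principal unit. The same bound lets `c` replace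
  -- `b` in the next extraction.
  have hlt : A.valuation (ℓ : L) < A.valuation c ^ (ℓ - 1) := by
    by_contra hcon
    rw [not_lt] at hcon
    have h1 : A.valuation b ≤ A.valuation (ℓ : L) * A.valuation c := by
      rw [eb]
      refine (A.valuation.map_add _ _).trans (max_le ?_ hls)
      rw [map_pow, hℓ1, pow_succ, ← hℓ1]
      exact mul_le_mul_left hcon _
    have h2 : A.valuation (ℓ : L) * A.valuation c < A.valuation (ℓ : L) :=
      mul_lt_of_lt_one_right hvl hc1
    exact (h1.trans_lt h2).not_ge hℓb
  refine ⟨hc0, hc1, hlt.le.trans ?_, ?_⟩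
  · have : ℓ - 1 = (ℓ - 2) + 1 := by have := hℓ.two_le; omega
    rw [this, pow_succ]
    exact mul_le_of_le_one_left' (pow_le_one' hcv _)
  · have e2 : b = c ^ ℓ * (1 + ℓ * s / c ^ (ℓ - 1)) := by
      rw [eb, mul_add, mul_one]
      congr 1
      have : c ^ ℓ = c ^ (ℓ - 1) * c := by rw [← pow_succ, ← hℓ1]
      rw [this]
      field_simp
    have hw : A.valuation (ℓ * s / c ^ (ℓ - 1)) < 1 := by
      rw [map_div₀, map_mul, map_pow]
      have hpos : 0 < A.valuation c ^ (ℓ - 1) := hvl.trans hlt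
      rw [div_lt_one₀ hpos]
      exact (mul_le_of_le_one_right' hsv).trans_lt hlt
    have hne : 1 + (ℓ * s / c ^ (ℓ - 1) : L) ≠ 0 := by
      intro hcc
      rw [hcc, mul_zero] at e2
      exact hb0 e2
    rw [e2, hφ.map_mul _ _ (pow_ne_zero _ hc0) hne, hA _ hw, add_zero, hφ.map_pow hc0]

lemma exists_map_eq_pow_nsmul (n : ℕ) {b y : L} (hb0 : b ≠ 0) (hb : A.valuation b < 1)
    (hℓb : A.valuation (ℓ : L) ≤ A.valuation b) (h : y ^ ℓ ^ n = 1 + b) :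
    ∃ d : L, d ≠ 0 ∧ φ b = ℓ ^ n • φ d := by
  induction n generalizing b with
  | zero => exact ⟨b, hb0, by simp⟩
  | succ n ih =>
    obtain ⟨h1, h2, h3, h4⟩ := map_eq_nsmul_of_root hφ hℓ hA hℓ0 hℓA (c := y ^ ℓ ^ n - 1) hb0 hb
      hℓb (by rw [← h, pow_succ, pow_mul]; ring)
    obtain ⟨d, hd, e⟩ := ih h1 h2 h3 (by ring)
    exact ⟨d, hd, by rw [h4, e, smul_smul, pow_succ, mul_comm]⟩

/-- If the residue characteristic is `ℓ` and enough roots exist, the kernel of `φ` contains the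
units of a valuation ring of the base field whose residue characteristic is not `ℓ`. -/
theorem exists_unitGroup_le_of_roots {K : Type*} [Field K] [Algebra K L] (S : Set ℕ)
    (hroot : ∀ n ∈ S, ∀ t : K, t ≠ 0 → φ (algebraMap K L t) = 0 →
      ∃ y : L, y ^ ℓ ^ n = algebraMap K L t)
    (hsep : ∀ x : L, x ≠ 0 → (∀ n ∈ S, ∃ d : L, d ≠ 0 ∧ φ x = ℓ ^ n • φ d) → φ x = 0) :
    ∃ B : ValuationSubring K, (ℓ : K)⁻¹ ∈ B ∧
      ∀ x : K, x ≠ 0 → x ∈ B → x⁻¹ ∈ B → φ (algebraMap K L x) = 0 := by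
  set ι := algebraMap K L
  have hι : ∀ {x : K}, x ≠ 0 → ι x ≠ 0 := fun hx => (map_ne_zero ι).2 hx
  have hιℓ : ι (ℓ : K) = (ℓ : L) := map_natCast ι ℓ
  have hℓK : (ℓ : K) ≠ 0 := fun hc => hℓ0 (by rw [← hιℓ, hc, map_zero])
  have hvl : 0 < A.valuation (ℓ : L) := zero_lt_iff.2 (by simpa using hℓ0)
  have h1 : ∀ a : K, a ≠ 0 → A.valuation (ι a) < 1 → A.valuation (ℓ : L) ≤ A.valuation (ι a) →
      φ (ι a) = 0 := by
    intro a ha hva hℓa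
    have ht : (1 : K) + a ≠ 0 := by
      intro hc
      rw [← neg_eq_iff_add_eq_zero.2 hc, map_neg, _root_.map_one, Valuation.map_neg,
        Valuation.map_one] at hva
      exact lt_irrefl _ hva
    refine hsep _ (hι ha) fun n hn => ?_
    obtain ⟨y, hy⟩ := hroot n hn (1 + a) ht (by rw [map_add, _root_.map_one]; exact hA _ hva)
    exact exists_map_eq_pow_nsmul hφ hℓ hA hℓ0 hℓA n (hι ha) hva hℓa
      (by rw [hy, map_add, _root_.map_one])
  have hℓφ : φ (ℓ : L) = 0 := by
    have := h1 ℓ hℓK (by rwa [hιℓ]) (by rw [hιℓ])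
    rwa [hιℓ] at this
  -- A unit `a` is reached through `ℓ * a`, which has the value of `ℓ` and so is covered by `h1`.
  have h2 : ∀ a : K, a ≠ 0 → A.valuation (ι a) = 1 → φ (ι a) = 0 := by
    intro a ha hva
    have hv : A.valuation (ι (ℓ * a)) = A.valuation (ℓ : L) := by
      rw [map_mul, hιℓ, map_mul, hva, mul_one]
    have := h1 (ℓ * a) (mul_ne_zero hℓK ha) (by rwa [hv]) (by rw [hv])
    rwa [map_mul, hιℓ, hφ.map_mul _ _ hℓ0 (hι ha), hℓφ, zero_add] at this
  have h3 : ∀ n : ℕ, ∀ a : K, a ≠ 0 → A.valuation (ι a) ≤ 1 →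
      A.valuation (ℓ : L) ^ n ≤ A.valuation (ι a) → φ (ι a) = 0 := by
    intro n
    induction n with
    | zero =>
      intro a ha hva h
      rw [pow_zero] at h
      exact h2 a ha (le_antisymm hva h)
    | succ n ih =>
      intro a ha hva h
      by_cases hℓa : A.valuation (ℓ : L) ≤ A.valuation (ι a)
      · rcases hva.lt_or_eq with h4 | h4
        · exact h1 a ha h4 hℓa
        · exact h2 a ha h4
      · rw [not_le] at hℓa
        have hv : A.valuation (ι (a / ℓ)) = A.valuation (ι a) / A.valuation (ℓ : L) := by
          rw [map_div₀, hιℓ, map_div₀]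
        have := ih (a / ℓ) (div_ne_zero ha hℓK) (by rw [hv]; exact (div_le_one₀ hvl).2 hℓa.le)
          (by rw [hv, le_div_iff₀ hvl, ← pow_succ]; exact h)
        rwa [map_div₀, hιℓ, hφ.map_div (hι ha) hℓ0, hℓφ, sub_zero] at this
  have hpow : ∀ n m : ℕ, ∀ x : K, A.valuation (ι (ℓ ^ n * x)) ≤ 1 →
      A.valuation (ι (ℓ ^ (n + m) * x)) ≤ 1 := by
    intro n m x hx
    have e : (ℓ : K) ^ (n + m) * x = ℓ ^ m * (ℓ ^ n * x) := by ring
    rw [e, map_mul, map_pow, hιℓ, map_mul, map_pow]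
    exact mul_le_one' (pow_le_one' hℓA.le m) hx
  -- This is `A ∩ K` with `ℓ` inverted; its units have values between integral powers of that of
  -- `ℓ`, which is the range treated in `h3`.
  let B : ValuationSubring K :=
    { carrier := {x | ∃ n : ℕ, A.valuation (ι (ℓ ^ n * x)) ≤ 1}
      mul_mem' := by
        rintro x y ⟨n, hn⟩ ⟨m, hm⟩
        refine ⟨n + m, ?_⟩
        have e : (ℓ : K) ^ (n + m) * (x * y) = ℓ ^ n * x * (ℓ ^ m * y) := by ring
        rw [e, map_mul, map_mul]
        exact mul_le_one' hn hm
      one_mem' := ⟨0, by simp⟩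
      zero_mem' := ⟨0, by simp⟩
      add_mem' := by
        rintro x y ⟨n, hn⟩ ⟨m, hm⟩
        refine ⟨n + m, ?_⟩
        rw [mul_add, map_add]
        refine (A.valuation.map_add _ _).trans (max_le (hpow n m x hn) ?_)
        rw [add_comm]
        exact hpow m n y hm
      neg_mem' := by
        rintro x ⟨n, hn⟩
        exact ⟨n, by rwa [mul_neg, map_neg, Valuation.map_neg]⟩
      mem_or_inv_mem' := fun x => by
        rcases le_total (A.valuation (ι x)) 1 with h | h
        · exact Or.inl ⟨0, by simpa using h⟩
        · refine Or.inr ⟨0, ?_⟩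
          rw [pow_zero, one_mul, map_inv₀, map_inv₀]
          exact inv_le_one_of_one_le₀ h }
  refine ⟨B, ⟨1, by rw [pow_one, mul_inv_cancel₀ hℓK]; simp⟩, ?_⟩
  rintro x hx ⟨n, hn⟩ ⟨m, hm⟩
  have := h3 (n + m) (ℓ ^ n * x) (mul_ne_zero (pow_ne_zero n hℓK) hx) hn (by
    have e : (ℓ : L) ^ (n + m) = ι (ℓ ^ n * x) * ι (ℓ ^ m * x⁻¹) := by
      rw [← map_mul]
      have : (ℓ : K) ^ n * x * (ℓ ^ m * x⁻¹) = ℓ ^ (n + m) := by field_simp; ring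
      rw [this, map_pow, hιℓ]
    rw [← map_pow, e, map_mul]
    exact mul_le_of_le_one_right' hm)
  rwa [map_mul, map_pow, hιℓ, hφ.map_mul _ _ (pow_ne_zero n hℓ0) (hι hx), hφ.map_pow hℓ0, hℓφ,
    smul_zero, zero_add] at this

end Descent

universe u

/-! ### From homomorphisms on units to valuations of the base field -/

section UnitLog

/-- Extension by zero of a homomorphism defined on units. -/
noncomputable def unitLog {L V : Type*} [Field L] [AddCommGroup V] (ψ : Additive Lˣ →+ V) (x : L) :
    V :=
  open Classical in if h : x = 0 then 0 else ψ (Additive.ofMul (Units.mk0 x h))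

variable {L V : Type*} [Field L] [AddCommGroup V]

lemma unitLog_mk0 (ψ : Additive Lˣ →+ V) {x : L} (h : x ≠ 0) :
    unitLog ψ x = ψ (Additive.ofMul (Units.mk0 x h)) := by
  rw [unitLog, dif_neg h]

lemma unitLog_coe (ψ : Additive Lˣ →+ V) (u : Lˣ) : unitLog ψ u = ψ (Additive.ofMul u) := by
  rw [unitLog_mk0 ψ u.ne_zero, Units.mk0_val]

lemma isLogMap_unitLog {ψ : Additive Lˣ →+ V} (h : ψ (Additive.ofMul (-1)) = 0) :
    IsLogMap (unitLog ψ) where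
  map_mul x y hx hy := by
    rw [unitLog_mk0 ψ hx, unitLog_mk0 ψ hy, unitLog_mk0 ψ (mul_ne_zero hx hy), Units.mk0_mul,
      ofMul_mul, map_add]
  map_neg_one := by
    have : (-1 : L) = ((-1 : Lˣ) : L) := by simp
    rw [this, unitLog_coe, h]

/-- If `ψ x` and `ψ (1 - x)` are always dependent and sufficiently many roots exist in `L`, then
the restriction of `ψ` to `K` comes from a valuation of residue characteristic different from
`ℓ`. -/
theorem exists_valuationSubring_of_unitLog {K k : Type*} [Field K] [Algebra K L] [Field k]
    [Module k V] {ψ : Additive Lˣ →+ V} {ℓ : ℕ} (hℓ : ℓ.Prime) (hℓ0 : (ℓ : K) ≠ 0)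
    (hneg : ψ (Additive.ofMul (-1)) = 0)
    (hdep : ∀ x y : Lˣ, (y : L) = 1 - x → Dependent k (ψ (Additive.ofMul x)) (ψ (Additive.ofMul y)))
    (harch : ∀ α : k, α ≠ 0 → ∀ x : Additive Lˣ,
      (∀ r : ℕ, ∃ z : Additive Lˣ, ((r : k) + α) • ψ z = α • ψ x) →
      (∀ r : ℕ, ∃ z : Additive Lˣ, ((r : k) + α⁻¹) • ψ z = α⁻¹ • ψ x) → ψ x = 0)
    (hk : (2 : k) ≠ 0 ∨ ∀ c : k, c = 0 ∨ c = 1) (S : Set ℕ)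
    (hroot : ∀ n ∈ S, ∀ t : Kˣ, ψ (Additive.ofMul (Units.map (algebraMap K L : K →* L) t)) = 0 →
      ∃ y : L, y ^ ℓ ^ n = algebraMap K L t)
    (hsep : ∀ x : Additive Lˣ, (∀ n ∈ S, ∃ d : Additive Lˣ, ψ x = ℓ ^ n • ψ d) → ψ x = 0) :
    ∃ B : ValuationSubring K, (ℓ : K)⁻¹ ∈ B ∧
      (∀ u ∈ B.principalUnitGroup,
        ψ (Additive.ofMul (Units.map (algebraMap K L : K →* L) u)) = 0) ∧
      ∃ v : V, ∀ u ∈ B.unitGroup, ∃ c : k,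
        ψ (Additive.ofMul (Units.map (algebraMap K L : K →* L) u)) = c • v := by
  have hφ := isLogMap_unitLog hneg
  set φ := unitLog ψ
  set ι := algebraMap K L
  have hmk : ∀ {x : L} (h : x ≠ 0), φ x = ψ (Additive.ofMul (Units.mk0 x h)) := unitLog_mk0 ψ
  have hcoe : ∀ u : Kˣ, φ (ι u) = ψ (Additive.ofMul (Units.map (ι : K →* L) u)) := fun u =>
    unitLog_coe ψ (Units.map (ι : K →* L) u)
  have hex : ∀ (w : V) (α β : k) (x : L), (∃ z : L, z ≠ 0 ∧ α • φ z = β • w) →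
      ∃ z : Additive Lˣ, α • ψ z = β • w := by
    rintro w α β x ⟨z, hz, e⟩
    exact ⟨Additive.ofMul (Units.mk0 z hz), by rwa [← hmk]⟩
  obtain ⟨A, hA1, v, hA2⟩ := exists_valuationSubring_of_dependent (k := k) hφ
    (fun x hx hx1 => by
      have := hdep (Units.mk0 (-x) (neg_ne_zero.2 hx)) (Units.mk0 (1 + x) hx1) (by simp)
      rwa [← hmk, ← hmk, hφ.map_neg hx] at this)
    (fun α hα x hx h1 h2 => by
      have := harch α hα (Additive.ofMul (Units.mk0 x hx))
      rw [← hmk hx] at this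
      exact this (fun r => hex _ _ _ x (h1 r)) (fun r => hex _ _ _ x (h2 r))) hk
  have hA1' : ∀ x : L, A.valuation x < 1 → φ (1 + x) = 0 := by
    intro x hx
    rcases valuation_lt_one_iff_inv.1 hx with rfl | h
    · rw [add_zero, hφ.map_one]
    · exact hA1 x (mem_of_inv_notMem h) h
  -- If `ℓ` is a unit of `A`, contraction to `K` suffices; if not, the roots provide a coarser ring
  -- on whose units the map vanishes, and the line may be taken zero.
  by_cases hcase : (ℓ : L)⁻¹ ∈ A
  · refine ⟨A.comap ι, ?_, fun u hu => ?_, v, fun u hu => ?_⟩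
    · rw [ValuationSubring.mem_comap, map_inv₀, map_natCast]
      exact hcase
    · rw [← hcoe]
      rcases (mem_principalUnitGroup_iff_mem _ _).1 hu with h | h
      · rw [sub_eq_zero.1 h, map_one, hφ.map_one]
      · rw [ValuationSubring.mem_comap, map_inv₀] at h
        have := hA1 _ (mem_of_inv_notMem h) h
        rwa [map_sub, map_one, add_sub_cancel] at this
    · rw [mem_unitGroup_iff_mem, ValuationSubring.mem_comap, ValuationSubring.mem_comap,
        map_inv₀] at hu
      rw [← hcoe]
      exact hA2 _ ((map_ne_zero ι).2 u.ne_zero) hu.1 hu.2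
  · have hℓL : (ℓ : L) ≠ 0 := by
      rw [← map_natCast ι]
      exact (map_ne_zero ι).2 hℓ0
    obtain ⟨B, hB1, hB2⟩ := exists_unitGroup_le_of_roots hφ hℓ hA1' hℓL
      (valuation_lt_one_iff_inv.2 (Or.inr hcase)) (K := K) S
      (fun n hn t ht h => hroot n hn (Units.mk0 t ht) (by rw [← hcoe]; exact h))
      (fun x hx h => by
        rw [hmk hx] at h ⊢
        refine hsep _ fun n hn => ?_
        obtain ⟨d, hd, e⟩ := h n hn
        exact ⟨Additive.ofMul (Units.mk0 d hd), by rw [e, hmk hd]⟩)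
    have hB3 : ∀ u ∈ B.unitGroup, ψ (Additive.ofMul (Units.map (ι : K →* L) u)) = 0 := by
      intro u hu
      rw [mem_unitGroup_iff_mem] at hu
      rw [← hcoe]
      exact hB2 _ u.ne_zero hu.1 hu.2
    exact ⟨B, hB1, fun u hu => hB3 u (B.principal_units_le_units hu), 0,
      fun u hu => ⟨0, by rw [hB3 u hu, smul_zero]⟩⟩

/-- The canonical valuation of a subgroup containing the units of a valuation ring with residue
characteristic different from `ℓ`. -/
lemma exists_canonical_of_unitGroup_le {K : Type*} [Field K] {ℓ : ℕ} (hℓ0 : (ℓ : K) ≠ 0)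
    {T H : Subgroup Kˣ} {B : ValuationSubring K} (hB : (ℓ : K)⁻¹ ∈ B)
    (hB1 : B.principalUnitGroup ≤ T) (hB2 : B.unitGroup ≤ H) :
    IsValuative H ∧ ∃ A : ValuationSubring K, IsCanonicalValuation A H ∧
      A.principalUnitGroup ≤ T ∧ A.unitGroup ≤ H ∧ ringChar (IsLocalRing.ResidueField A) ≠ ℓ := by
  have hv : IsValuative H := ⟨B, hB2⟩
  obtain ⟨A, hA⟩ := hv.exists_isCanonicalValuation
  have hBA : B ≤ A := hA.2 hB2
  exact ⟨hv, A, hA, (ValuationSubring.principalUnitGroup_le_principalUnitGroup.2 hBA).trans hB1,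
    hA.1, ringChar_residueField_ne hℓ0 (hBA hB)⟩

end UnitLog

/-! ### The mod-`ℓ` case -/

section ModEllCase

lemma isCyclic_closure_pair {G : Type*} [CommGroup G] {a b z : G} {m n : ℤ} (ha : a = z ^ m)
    (hb : b = z ^ n) : IsCyclic (Subgroup.closure ({a, b} : Set G)) := by
  have hle : Subgroup.closure ({a, b} : Set G) ≤ Subgroup.zpowers z := by
    rw [Subgroup.closure_le]
    rintro c (rfl | rfl)
    · exact ⟨m, ha.symm⟩
    · exact ⟨n, hb.symm⟩
  exact isCyclic_of_injective (Subgroup.inclusion hle) (Subgroup.inclusion_injective hle)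

lemma exists_mem_zpow_of_isCyclic_closure {G : Type*} [CommGroup G] {a b : G}
    (h : IsCyclic (Subgroup.closure ({a, b} : Set G))) :
    ∃ (z : G) (m n : ℤ), a = z ^ m ∧ b = z ^ n := by
  obtain ⟨⟨z, hz⟩, hgen⟩ := h.exists_generator
  obtain ⟨m, hm⟩ := hgen ⟨a, Subgroup.subset_closure (by simp)⟩
  obtain ⟨n, hn⟩ := hgen ⟨b, Subgroup.subset_closure (by simp)⟩
  exact ⟨z, m, n, by simpa using (congrArg Subtype.val hm).symm,
    by simpa using (congrArg Subtype.val hn).symm⟩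

lemma add_neg_zsmul_eq {A : Type*} [AddCommGroup A] (x y g : A) {m n k p : ℤ}
    (h : p = n - m * k) :
    y + (-k) • x = -(n • g) + y + (-k) • (-(m • g) + x) + p • g := by
  subst h
  module

lemma mul_zpow_neg_eq {G : Type*} [CommGroup G] (x y g : G) {m n k p : ℤ} (h : p = n - m * k) :
    y * x ^ (-k) = (g ^ n)⁻¹ * y * ((g ^ m)⁻¹ * x) ^ (-k) * g ^ p :=
  add_neg_zsmul_eq (A := Additive G) x y g h

lemma exists_addMonoidHom_eq_zero_iff {L : Type u} [Field L] (T : Subgroup Lˣ) :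
    ∃ (W : Type u) (_ : AddCommGroup W) (ψ : Additive Lˣ →+ W), Function.Surjective ψ ∧
      ∀ u : Lˣ, ψ (Additive.ofMul u) = 0 ↔ u ∈ T :=
  ⟨Additive Lˣ ⧸ Subgroup.toAddSubgroup T, inferInstance,
    QuotientAddGroup.mk' (Subgroup.toAddSubgroup T), QuotientAddGroup.mk'_surjective _,
    fun u => QuotientAddGroup.eq_zero_iff (N := Subgroup.toAddSubgroup T) (Additive.ofMul u)⟩

section Exponent

variable {G : Type*} [CommGroup G] {ℓ : ℕ} {H H' : Subgroup G}

lemma zpow_mem_of_dvd (hpow : ∀ y : G, y ^ ℓ ∈ H) (z : G) {m : ℤ} (hm : (ℓ : ℤ) ∣ m) :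
    z ^ m ∈ H := by
  obtain ⟨c, rfl⟩ := hm
  rw [zpow_mul, zpow_natCast]
  exact H.zpow_mem (hpow z) c

lemma dvd_of_zpow_mem (hℓ : ℓ.Prime) (hpow : ∀ y : G, y ^ ℓ ∈ H) {z : G} {m : ℤ} (hz : z ∉ H)
    (hzm : z ^ m ∈ H) : (ℓ : ℤ) ∣ m := by
  by_contra hm
  obtain ⟨a, b, hab⟩ := (Prime.coprime_iff_not_dvd (Nat.prime_iff_prime_int.1 hℓ)).2 hm
  apply hz
  have : z = (z ^ m) ^ b * z ^ ((ℓ : ℤ) * a) := by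
    rw [← zpow_mul, ← zpow_add]
    have : m * b + ℓ * a = 1 := by linear_combination hab
    rw [this, zpow_one]
  rw [this]
  exact H.mul_mem (H.zpow_mem hzm b) (zpow_mem_of_dvd hpow z ⟨a, rfl⟩)

/-- A cyclic quotient of exponent dividing `ℓ` is generated by any nontrivial class: the exponent
`m` of `x` is prime to `ℓ`, and a Bézout coefficient inverts it. -/
lemma exists_mul_zpow_mem (hℓ : ℓ.Prime) (hpow : ∀ y : G, y ^ ℓ ∈ H) (hcyc : IsCyclic (G ⧸ H))
    {x : G} (hx : x ∉ H) (y : G) : ∃ k : ℤ, y * x ^ (-k) ∈ H := by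
  obtain ⟨g, hg⟩ := hcyc.exists_generator
  obtain ⟨g, rfl⟩ := QuotientGroup.mk_surjective g
  obtain ⟨m, hm⟩ := hg (x : G ⧸ H)
  obtain ⟨n, hn⟩ := hg (y : G ⧸ H)
  have hm' : (g ^ m)⁻¹ * x ∈ H := QuotientGroup.eq.1 hm
  have hn' : (g ^ n)⁻¹ * y ∈ H := QuotientGroup.eq.1 hn
  have hmℓ : ¬ (ℓ : ℤ) ∣ m := by
    intro hc
    apply hx
    have := H.mul_mem (zpow_mem_of_dvd hpow g hc) hm'
    rwa [mul_inv_cancel_left] at this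
  obtain ⟨a, b, hab⟩ := (Prime.coprime_iff_not_dvd (Nat.prime_iff_prime_int.1 hℓ)).2 hmℓ
  refine ⟨b * n, ?_⟩
  rw [mul_zpow_neg_eq x y g (m := m) (n := n) (k := b * n) (p := ℓ * (a * n))
    (by linear_combination n * hab)]
  exact H.mul_mem (H.mul_mem hn' (H.zpow_mem hm' _)) (zpow_mem_of_dvd hpow g ⟨_, rfl⟩)

/-- Modulo `H ⊓ H'` the element `y * x ^ (-k)` is a power of a common generator `z ∉ H`. Lying in
`H`, it has exponent divisible by `ℓ`, and `ℓ`-th powers lie in `H'` too. -/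
lemma mem_of_isCyclic_closure (hℓ : ℓ.Prime) (hpow : ∀ y : G, y ^ ℓ ∈ H)
    (hpow' : ∀ y : G, y ^ ℓ ∈ H') {x y : G} (hx : x ∉ H)
    (hcyc : IsCyclic (Subgroup.closure ({(x : G ⧸ H ⊓ H'), (y : G ⧸ H ⊓ H')} : Set _)))
    {k : ℤ} (hk : y * x ^ (-k) ∈ H) : y * x ^ (-k) ∈ H' := by
  obtain ⟨z, p, q, hp, hq⟩ := exists_mem_zpow_of_isCyclic_closure hcyc
  obtain ⟨z, rfl⟩ := QuotientGroup.mk_surjective z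
  have hp' : (z ^ p)⁻¹ * x ∈ H ⊓ H' := QuotientGroup.eq.1 hp.symm
  have hq' : (z ^ q)⁻¹ * y ∈ H ⊓ H' := QuotientGroup.eq.1 hq.symm
  have hz : z ∉ H := by
    intro hc
    apply hx
    have := H.mul_mem (H.zpow_mem hc p) hp'.1
    rwa [mul_inv_cancel_left] at this
  have e : z ^ (q - p * k) = (y * x ^ (-k)) * (((z ^ q)⁻¹ * y) * ((z ^ p)⁻¹ * x) ^ (-k))⁻¹ := by
    rw [mul_zpow_neg_eq x y z (m := p) (n := q) (k := k) rfl, mul_inv_cancel_comm]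
  have hin : ((z ^ q)⁻¹ * y) * ((z ^ p)⁻¹ * x) ^ (-k) ∈ H ⊓ H' :=
    Subgroup.mul_mem _ hq' (Subgroup.zpow_mem _ hp' _)
  have hd := dvd_of_zpow_mem hℓ hpow hz (by rw [e]; exact H.mul_mem hk (H.inv_mem hin.1))
  have := H'.mul_mem (zpow_mem_of_dvd hpow' z hd) hin.2
  rwa [e, inv_mul_cancel_right] at this

end Exponent

/-- If `𝐇(T) = T`, then `x` and `1 - x` are dependent modulo `T`. -/
lemma exists_zpow_of_boldH_eq {L : Type*} [Field L] {ℓ : ℕ} (hℓ : ℓ.Prime) {T : Subgroup Lˣ}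
    (hpow : ∀ y : Lˣ, y ^ ℓ ∈ T) (hT : boldH T = T) {x y : Lˣ} (hxy : (y : L) = 1 - x)
    (hx : x ∉ T) : ∃ i : ℤ, y * x ^ i ∈ T := by
  have hsep : ∀ w : Lˣ, w ∉ T → ∃ H : Subgroup Lˣ, w ∉ H ∧ T ≤ H ∧ IsCyclic (Lˣ ⧸ H) ∧
      ∀ H' : Subgroup Lˣ, T ≤ H' → IsCyclic (Lˣ ⧸ H') → IsRigid (H ⊓ H') := by
    intro w hw
    rw [← hT, boldH, Subgroup.mem_sInf] at hw
    push Not at hw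
    obtain ⟨H, hH, hwH⟩ := hw
    exact ⟨H, hwH, hH⟩
  obtain ⟨H, hxH, hTH, hcyc, hrig⟩ := hsep x hx
  obtain ⟨k, hk⟩ := exists_mul_zpow_mem hℓ (fun z => hTH (hpow z)) hcyc hxH y
  refine ⟨-k, ?_⟩
  by_contra hw
  -- Only cocyclicity of `H'` matters here; rigidity of `H ⊓ H'` is part of the choice of `H`.
  obtain ⟨H', hwH', hTH', hcyc', -⟩ := hsep _ hw
  exact hwH' (mem_of_isCyclic_closure hℓ (fun z => hTH (hpow z)) (fun z => hTH' (hpow z)) hxH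
    (hrig H' hTH' hcyc' x y hxy fun hc => hxH hc.1) hk)

lemma zmod_two_eq_zero_or_one : ∀ c : ZMod 2, c = 0 ∨ c = 1 := by decide

/-- Stated for any extension `L` containing an `ℓ`-th root of each element of `T`, the only property
of the Kummer extension that enters. -/
theorem boldH_eq_and_exists_valuation {K L : Type*} [Field K] [Field L] [Algebra K L] {ℓ : ℕ} (hℓ : ℓ.Prime)
    (hℓ0 : (ℓ : K) ≠ 0) {T : Subgroup Kˣ} (hneg : (-1 : Kˣ) ∈ T)
    (hroot : ∀ t ∈ T, ∃ y : L, y ^ ℓ = algebraMap K L (t : K)) {T' : Subgroup Lˣ}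
    (hpow : ∀ y : Lˣ, y ^ ℓ ∈ T') (hcomap : T'.comap (Units.map (algebraMap K L : K →* L)) = T)
    (hT' : boldH T' = T') :
    boldH T = T ∧ ∃ H : Subgroup Kˣ, T ≤ H ∧ IsCyclic (H ⧸ T.subgroupOf H) ∧ IsValuative H ∧
      ∃ A : ValuationSubring K, IsCanonicalValuation A H ∧ A.principalUnitGroup ≤ T ∧
        A.unitGroup ≤ H ∧ ringChar (IsLocalRing.ResidueField A) ≠ ℓ := by
  have : Fact ℓ.Prime := ⟨hℓ⟩
  set ι : Kˣ →* Lˣ := Units.map (algebraMap K L : K →* L) with hι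
  have hmem : ∀ x : Kˣ, x ∈ T ↔ ι x ∈ T' := fun x => by rw [← hcomap]; rfl
  have hdepL : ∀ x y : Lˣ, (y : L) = 1 - x → x ∉ T' → ∃ i : ℤ, y * x ^ i ∈ T' :=
    fun x y hxy hx => exists_zpow_of_boldH_eq hℓ hpow hT' hxy hx
  refine ⟨le_antisymm ?_ (le_sInf fun H hH => hH.1), ?_⟩
  · intro x hx
    rw [hmem, ← hT', boldH, Subgroup.mem_sInf]
    intro H hH
    refine (Subgroup.mem_sInf.1 hx (H.comap ι) ⟨?_, ?_, ?_⟩ : x ∈ H.comap ι)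
    · intro t ht
      exact hH.1 ((hmem t).1 ht)
    · have := hH.2.1
      refine isCyclic_of_injective (QuotientGroup.map (H.comap ι) H ι le_rfl) ?_
      rw [← MonoidHom.ker_eq_bot_iff, eq_bot_iff]
      intro a
      induction a using QuotientGroup.induction_on with
      | H a =>
        intro ha
        rw [MonoidHom.mem_ker, QuotientGroup.map_mk, QuotientGroup.eq_one_iff] at ha
        rw [Subgroup.mem_bot, QuotientGroup.eq_one_iff]
        exact ha
    · intro H' hTH' _ a b hab ha
      have haT : ι a ∉ T' := fun hc =>
        ha ⟨hH.1 hc, hTH' ((hmem a).2 hc)⟩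
      obtain ⟨i, hi⟩ := hdepL (ι a) (ι b) (by simp [hι, hab]) haT
      rw [← map_zpow, ← map_mul, ← hmem] at hi
      refine isCyclic_closure_pair (z := (a : Kˣ ⧸ H.comap ι ⊓ H')) (m := 1) (n := -i)
        (by simp) ?_
      rw [← QuotientGroup.mk_zpow, QuotientGroup.eq, ← inv_mem_iff]
      have : (b⁻¹ * a ^ (-i))⁻¹ = b * a ^ i := by
        rw [mul_inv_rev, inv_inv, zpow_neg, inv_inv, mul_comm]
      rw [this]
      exact ⟨hH.1 ((hmem _).1 hi), hTH' hi⟩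
  obtain ⟨W, _, ψ, hψs, hψ⟩ := exists_addMonoidHom_eq_zero_iff T'
  let _ : Module (ZMod ℓ) W := AddCommGroup.zmodModule (n := ℓ) (by
    intro w
    obtain ⟨u, rfl⟩ := hψs w
    rw [← map_nsmul]
    exact (hψ _).2 (hpow u.toMul))
  have hex : ∀ α : ZMod ℓ, ((-α).val : ZMod ℓ) + α = 0 := by
    intro α
    rw [ZMod.natCast_val, ZMod.cast_id', id, neg_add_cancel]
  obtain ⟨B, hB, hB1, v, hB2⟩ := exists_valuationSubring_of_unitLog (K := K) (k := ZMod ℓ)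
    (ψ := ψ) hℓ hℓ0 (by
      rw [hψ]
      have := (hmem _).1 hneg
      simpa [hι] using this)
    (by
      intro x y hxy
      by_cases hx : x ∈ T'
      · exact ⟨1, 0, Or.inl one_ne_zero, by rw [(hψ x).2 hx]; simp⟩
      · obtain ⟨i, hi⟩ := hdepL x y hxy hx
        refine ⟨i, 1, Or.inr one_ne_zero, ?_⟩
        rw [← hψ, ofMul_mul, ofMul_zpow, map_add, map_zsmul] at hi
        rw [Int.cast_smul_eq_zsmul, one_smul, add_comm]
        exact hi)
    (by
      intro α hα x h1 _
      -- Over `𝔽_ℓ` the denominator `r + α` vanishes for a suitable natural number `r`, so already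
      -- the first family of equations is contradictory unless `φ x = 0`.
      obtain ⟨z, hz⟩ := h1 (-α).val
      rw [hex α, zero_smul] at hz
      exact (smul_eq_zero.1 hz.symm).resolve_left hα)
    (by
      by_cases h2 : ℓ = 2
      · right
        subst h2
        exact zmod_two_eq_zero_or_one
      · left
        have : ((2 : ℕ) : ZMod ℓ) ≠ 0 := by
          rw [Ne, ZMod.natCast_eq_zero_iff]
          intro hc
          exact h2 ((Nat.prime_dvd_prime_iff_eq hℓ Nat.prime_two).1 hc)
        simpa using this)
    -- One root extraction is enough, since `ℓ`-th powers are already trivial modulo `T'`.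
    {1} (by
      rintro n rfl t ht
      rw [hψ] at ht
      rw [pow_one]
      exact hroot t ((hmem t).2 ht))
    (by
      intro x h
      obtain ⟨d, hd⟩ := h 1 rfl
      rw [hd, pow_one, ← map_nsmul]
      exact (hψ _).2 (hpow (Additive.toMul d)))
  let H : Subgroup Kˣ :=
    { carrier := {x | ∃ c : ZMod ℓ, ψ (Additive.ofMul (ι x)) = c • v}
      mul_mem' := by
        rintro a b ⟨c, hc⟩ ⟨d, hd⟩
        exact ⟨c + d, by rw [map_mul, ofMul_mul, map_add, hc, hd, add_smul]⟩
      one_mem' := ⟨0, by rw [map_one, ofMul_one, map_zero, zero_smul]⟩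
      inv_mem' := by
        rintro a ⟨c, hc⟩
        exact ⟨-c, by rw [map_inv, ofMul_inv, map_neg, hc, neg_smul]⟩ }
  have hTH : T ≤ H := fun t ht => ⟨0, by rw [(hψ _).2 ((hmem t).1 ht), zero_smul]⟩
  refine ⟨H, hTH, ?_, exists_canonical_of_unitGroup_le hℓ0 hB
    (fun u hu => (hmem u).2 ((hψ _).1 (hB1 u hu))) (fun u hu => hB2 u hu)⟩
  -- `H / T` embeds in a line over `𝔽_ℓ`, so any element outside `T` generates.
  by_cases hex0 : ∃ h₀ ∈ H, h₀ ∉ T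
  · obtain ⟨h₀, hh, hhT⟩ := hex0
    obtain ⟨c₀, hc₀⟩ := id hh
    have hne : c₀ ≠ 0 := by
      rintro rfl
      rw [zero_smul, hψ, ← hmem] at hc₀
      exact hhT hc₀
    refine ⟨((⟨h₀, hh⟩ : H) : H ⧸ T.subgroupOf H), fun a => ?_⟩
    induction a using QuotientGroup.induction_on with
    | H a =>
      obtain ⟨a, c, hc⟩ := a
      refine ⟨((c / c₀).val : ℤ), ?_⟩
      change ((⟨h₀, hh⟩ : H) : H ⧸ T.subgroupOf H) ^ _ = _
      rw [← QuotientGroup.mk_zpow, QuotientGroup.eq, Subgroup.mem_subgroupOf, hmem, ← hψ]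
      simp only [zpow_natCast, Subgroup.coe_mul, Subgroup.coe_inv, Subgroup.coe_pow, map_mul,
        map_inv, map_pow, ofMul_mul, ofMul_inv, ofMul_pow, map_add, map_neg, map_nsmul]
      rw [hc, hc₀, ← Nat.cast_smul_eq_nsmul (ZMod ℓ), ZMod.natCast_val, ZMod.cast_id', id, smul_smul,
        div_mul_cancel₀ _ hne, neg_add_cancel]
  · push Not at hex0
    have : Subsingleton (H ⧸ T.subgroupOf H) := by
      refine ⟨fun a b => ?_⟩
      induction a using QuotientGroup.induction_on with
      | H a =>
        induction b using QuotientGroup.induction_on with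
        | H b =>
          rw [QuotientGroup.eq, Subgroup.mem_subgroupOf]
          exact hex0 _ (a⁻¹ * b).2
    infer_instance

end ModEllCase

/-! ### `ℓ`-adic completions and the ring `ℤ_ℓ` -/

section Completion

variable {ℓ : ℕ} {G : Type*} [AddCommGroup G]

lemma ellIdeal_fg (ℓ : ℕ) : (ellIdeal ℓ).FG := ⟨{(ℓ : ℤ)}, by simp⟩

lemma ellIdeal_pow (ℓ n : ℕ) : ellIdeal ℓ ^ n = Ideal.span {(ℓ : ℤ) ^ n} :=
  Ideal.span_singleton_pow _ _

lemma exists_eq_pow_smul_of_eval_eq_zero {n : ℕ} {x : AdicCompletion (ellIdeal ℓ) G}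
    (hx : AdicCompletion.eval (ellIdeal ℓ) G n x = 0) :
    ∃ y : AdicCompletion (ellIdeal ℓ) G, x = (ℓ : ZEll ℓ) ^ n • y := by
  have h : x ∈ (AdicCompletion.eval (ellIdeal ℓ) G n).ker := hx
  rw [← AdicCompletion.pow_smul_top_eq_ker_eval (ellIdeal_fg ℓ), ellIdeal_pow,
    Submodule.ideal_span_singleton_smul, Submodule.mem_smul_pointwise_iff_exists] at h
  obtain ⟨y, -, rfl⟩ := h
  refine ⟨y, ?_⟩
  rw [← algebraMap_smul (ZEll ℓ) ((ℓ : ℤ) ^ n) y, map_pow, map_natCast]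

lemma eval_pow_smul (n : ℕ) (y : AdicCompletion (ellIdeal ℓ) G) :
    AdicCompletion.eval (ellIdeal ℓ) G n ((ℓ : ZEll ℓ) ^ n • y) = 0 := by
  have h : (ℓ : ZEll ℓ) ^ n • y ∈ (AdicCompletion.eval (ellIdeal ℓ) G n).ker := by
    rw [← AdicCompletion.pow_smul_top_eq_ker_eval (ellIdeal_fg ℓ), ellIdeal_pow,
      Submodule.ideal_span_singleton_smul, Submodule.mem_smul_pointwise_iff_exists]
    exact ⟨y, trivial, by
      rw [← algebraMap_smul (ZEll ℓ) ((ℓ : ℤ) ^ n) y, map_pow, map_natCast]⟩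
  exact h

lemma eq_zero_of_forall_exists_pow_smul {x : AdicCompletion (ellIdeal ℓ) G}
    (h : ∀ n : ℕ, ∃ y, x = (ℓ : ZEll ℓ) ^ n • y) : x = 0 := by
  refine AdicCompletion.ext fun n => ?_
  obtain ⟨y, hy⟩ := h n
  have := eval_pow_smul n y
  rw [← hy] at this
  exact this

namespace ZEll

lemma eq_zero_of_forall_pow_dvd {x : ZEll ℓ} (h : ∀ n : ℕ, (ℓ : ZEll ℓ) ^ n ∣ x) : x = 0 :=
  eq_zero_of_forall_exists_pow_smul fun n => h n

lemma pow_dvd_iff_eval {n : ℕ} {x : ZEll ℓ} :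
    (ℓ : ZEll ℓ) ^ n ∣ x ↔ AdicCompletion.eval (ellIdeal ℓ) ℤ n x = 0 := by
  constructor
  · rintro ⟨y, rfl⟩
    exact eval_pow_smul n y
  · intro h
    exact exists_eq_pow_smul_of_eval_eq_zero h

lemma pow_dvd_intCast_iff {n : ℕ} {m : ℤ} : (ℓ : ZEll ℓ) ^ n ∣ (m : ZEll ℓ) ↔ (ℓ : ℤ) ^ n ∣ m := by
  rw [pow_dvd_iff_eval]
  change (Submodule.Quotient.mk m : ℤ ⧸ (ellIdeal ℓ ^ n • ⊤ : Ideal ℤ)) = 0 ↔ _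
  rw [Submodule.Quotient.mk_eq_zero, ellIdeal_pow, smul_eq_mul, Ideal.mul_top,
    Ideal.mem_span_singleton]

lemma exists_intCast (x : ZEll ℓ) (n : ℕ) : ∃ m : ℤ, (ℓ : ZEll ℓ) ^ n ∣ x - m := by
  obtain ⟨m, hm⟩ := Submodule.Quotient.mk_surjective _
    (AdicCompletion.eval (ellIdeal ℓ) ℤ n x)
  refine ⟨m, pow_dvd_iff_eval.2 ?_⟩
  rw [map_sub, sub_eq_zero, ← hm]
  rfl

variable [hp : Fact ℓ.Prime]

lemma exists_natCast (x : ZEll ℓ) (n : ℕ) : ∃ r : ℕ, (ℓ : ZEll ℓ) ^ n ∣ x - r := by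
  obtain ⟨m, hm⟩ := exists_intCast x n
  have hpos : (0 : ℤ) < (ℓ : ℤ) ^ n := pow_pos (by exact_mod_cast hp.out.pos) n
  refine ⟨(m % (ℓ : ℤ) ^ n).toNat, ?_⟩
  have h1 : (((m % (ℓ : ℤ) ^ n).toNat : ℕ) : ℤ) = m % (ℓ : ℤ) ^ n :=
    Int.toNat_of_nonneg (Int.emod_nonneg _ hpos.ne')
  have h2 : (ℓ : ℤ) ^ n ∣ m - m % (ℓ : ℤ) ^ n := Int.dvd_self_sub_emod
  rw [← h1] at h2
  have h4 := dvd_add hm ((pow_dvd_intCast_iff (ℓ := ℓ)).2 h2)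
  rw [Int.cast_sub, sub_add_sub_cancel, Int.cast_natCast] at h4
  exact h4

/-- Approximate `x` by an integer `m` modulo `ℓ ^ n`; then `ℓ ^ (n + 1)` divides `ℓ m`, and the
factor `ℓ` cancels in `ℤ`. -/
lemma eq_zero_of_mul_eq_zero {x : ZEll ℓ} (h : (ℓ : ZEll ℓ) * x = 0) : x = 0 := by
  apply eq_zero_of_forall_pow_dvd
  intro n
  obtain ⟨m, hm⟩ := exists_intCast x n
  have h1 : (ℓ : ZEll ℓ) ^ (n + 1) ∣ ((ℓ * m : ℤ) : ZEll ℓ) := by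
    have := mul_dvd_mul_left (ℓ : ZEll ℓ) hm
    rw [mul_sub, h, zero_sub, dvd_neg] at this
    rw [pow_succ', Int.cast_mul, Int.cast_natCast]
    exact this
  rw [pow_dvd_intCast_iff, pow_succ'] at h1
  have h2 : (ℓ : ℤ) ^ n ∣ m :=
    (mul_dvd_mul_iff_left (by exact_mod_cast hp.out.ne_zero)).1 h1
  have h3 := dvd_add hm ((pow_dvd_intCast_iff (ℓ := ℓ)).2 h2)
  rwa [sub_add_cancel] at h3

lemma isLocalRing_and_isUnit_or_dvd : IsLocalRing (ZEll ℓ) ∧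
    ∀ x : ZEll ℓ, IsUnit x ∨ (ℓ : ZEll ℓ) ∣ x := by
  have hmax : (ellIdeal ℓ).IsMaximal :=
    PrincipalIdealRing.isMaximal_of_irreducible (Nat.prime_iff_prime_int.1 hp.out).irreducible
  have h1 := AdicCompletion.isMaximal_map_of_le (ellIdeal ℓ) (ellIdeal ℓ) le_rfl (ellIdeal_fg ℓ)
  have h2 := AdicCompletion.isAdicComplete_self (ellIdeal ℓ) (ellIdeal_fg ℓ)
  have h3 := isLocalRing_of_isAdicComplete_maximal
    ((ellIdeal ℓ).map (algebraMap ℤ (AdicCompletion (ellIdeal ℓ) ℤ)))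
  refine ⟨h3, fun x => ?_⟩
  by_cases hx : IsUnit x
  · exact Or.inl hx
  right
  have h4 : x ∈ IsLocalRing.maximalIdeal (ZEll ℓ) := (IsLocalRing.mem_maximalIdeal x).2 hx
  rw [← IsLocalRing.eq_maximalIdeal h1, Ideal.map_span, Set.image_singleton,
    Ideal.mem_span_singleton, map_natCast] at h4
  exact h4

lemma exists_eq_pow_mul {x : ZEll ℓ} (hx : x ≠ 0) :
    ∃ n : ℕ, ∃ u : ZEll ℓ, IsUnit u ∧ x = (ℓ : ZEll ℓ) ^ n * u := by
  classical
  have h : ∃ n : ℕ, ¬ (ℓ : ZEll ℓ) ^ n ∣ x := by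
    by_contra! hc
    exact hx (eq_zero_of_forall_pow_dvd hc)
  obtain ⟨m, hm⟩ : ∃ m, Nat.find h = m + 1 := by
    refine Nat.exists_eq_succ_of_ne_zero fun h0 => ?_
    have := Nat.find_spec h
    rw [h0, pow_zero] at this
    exact this (one_dvd x)
  have h1 : (ℓ : ZEll ℓ) ^ m ∣ x := by
    by_contra hc
    exact Nat.find_min h (m := m) (by omega) hc
  have h2 := Nat.find_spec h
  rw [hm] at h2
  obtain ⟨u, rfl⟩ := h1
  refine ⟨m, u, (isLocalRing_and_isUnit_or_dvd.2 u).resolve_right fun hd => h2 ?_, rfl⟩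
  rw [pow_succ]
  exact mul_dvd_mul_left _ hd

lemma eq_zero_of_pow_mul_eq_zero {x : ZEll ℓ} (n : ℕ) (h : (ℓ : ZEll ℓ) ^ n * x = 0) : x = 0 := by
  induction n with
  | zero => simpa using h
  | succ n ih =>
    rw [pow_succ', mul_assoc] at h
    exact ih (eq_zero_of_mul_eq_zero h)

instance : IsDomain (ZEll ℓ) := by
  have : Nontrivial (ZEll ℓ) := isLocalRing_and_isUnit_or_dvd.1.toNontrivial
  have : NoZeroDivisors (ZEll ℓ) := ⟨by
    intro a b hab
    by_contra! hc
    obtain ⟨n, u, hu, rfl⟩ := exists_eq_pow_mul hc.1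
    rw [mul_assoc] at hab
    exact hc.2 (hu.mul_right_eq_zero.1 (eq_zero_of_pow_mul_eq_zero n hab))⟩
  exact NoZeroDivisors.to_isDomain _

lemma dvd_or_dvd (a b : ZEll ℓ) : a ∣ b ∨ b ∣ a := by
  by_cases ha : a = 0
  · exact Or.inr (ha ▸ dvd_zero b)
  by_cases hb : b = 0
  · exact Or.inl (hb ▸ dvd_zero a)
  obtain ⟨n, u, hu, rfl⟩ := exists_eq_pow_mul ha
  obtain ⟨m, v, hv, rfl⟩ := exists_eq_pow_mul hb
  rcases le_total n m with h | h
  · exact Or.inl ((hu.mul_right_dvd).2 ((pow_dvd_pow _ h).mul_right _))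
  · exact Or.inr ((hv.mul_right_dvd).2 ((pow_dvd_pow _ h).mul_right _))

omit hp in
lemma exists_limit (r : ℕ → ZEll ℓ) (hr : ∀ n m, n ≤ m → (ℓ : ZEll ℓ) ^ n ∣ r n - r m) :
    ∃ s : ZEll ℓ, ∀ n, (ℓ : ZEll ℓ) ^ n ∣ s - r n := by
  have h := AdicCompletion.isAdicComplete (I := ellIdeal ℓ) (M := ℤ) (ellIdeal_fg ℓ)
  obtain ⟨s, hs⟩ := h.toIsPrecomplete.prec (f := r) (by
    intro m n hmn
    rw [SModEq.sub_mem, AdicCompletion.pow_smul_top_eq_ker_eval (ellIdeal_fg ℓ)]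
    exact pow_dvd_iff_eval.1 (hr m n hmn))
  refine ⟨s, fun n => ?_⟩
  have := hs n
  rw [SModEq.sub_mem, AdicCompletion.pow_smul_top_eq_ker_eval (ellIdeal_fg ℓ)] at this
  rw [← dvd_neg, neg_sub]
  exact pow_dvd_iff_eval.2 this

lemma intCast_ne_zero {m : ℤ} (hm : m ≠ 0) : (m : ZEll ℓ) ≠ 0 := by
  intro h
  -- The exponent `|m|` is large enough, as `|m| < ℓ ^ |m|`.
  have h1 := (pow_dvd_intCast_iff (ℓ := ℓ) (n := m.natAbs)).1 (h ▸ dvd_zero _)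
  have h2 := Int.natAbs_dvd_natAbs.2 h1
  rw [Int.natAbs_pow, Int.natAbs_natCast] at h2
  exact (Nat.lt_pow_self hp.out.one_lt).not_ge (Nat.le_of_dvd (Int.natAbs_pos.2 hm) h2)

instance : IsPrincipalIdealRing (ZEll ℓ) := by
  classical
  refine ⟨fun J => ?_⟩
  by_cases hJ : J = ⊥
  · exact hJ ▸ bot_isPrincipal
  obtain ⟨x, hxJ, hx⟩ := Submodule.exists_mem_ne_zero_of_ne_bot hJ
  have hmem : ∀ n : ℕ, ∀ u : ZEll ℓ, IsUnit u → (ℓ : ZEll ℓ) ^ n * u ∈ J → (ℓ : ZEll ℓ) ^ n ∈ J :=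
    fun n u hu h => (J.mul_unit_mem_iff_mem hu).1 h
  have hex : ∃ n : ℕ, (ℓ : ZEll ℓ) ^ n ∈ J := by
    obtain ⟨n, u, hu, rfl⟩ := exists_eq_pow_mul hx
    exact ⟨n, hmem n u hu hxJ⟩
  refine ⟨(ℓ : ZEll ℓ) ^ Nat.find hex, le_antisymm (fun y hy => ?_) ?_⟩
  · rw [Ideal.submodule_span_eq, Ideal.mem_span_singleton]
    by_cases hy0 : y = 0
    · rw [hy0]; exact dvd_zero _
    obtain ⟨m, v, hv, rfl⟩ := exists_eq_pow_mul hy0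
    exact (pow_dvd_pow _ (Nat.find_min' hex (hmem m v hv hy))).mul_right _
  · rw [Ideal.submodule_span_eq, Ideal.span_singleton_le_iff_mem]
    exact Nat.find_spec hex

end ZEll

/-- The kernel of the `n`-th projection is `ℓ ^ n` times the completion, so closedness can be tested
by `ℓ`-adic approximation. -/
lemma IsClosedSub.mem {K : Type*} [Field K] {T : Submodule (ZEll ℓ) (KHat ℓ K)}
    (hT : IsClosedSub T) {x : KHat ℓ K}
    (h : ∀ n : ℕ, ∃ t ∈ T, ∃ y, x - t = (ℓ : ZEll ℓ) ^ n • y) : x ∈ T := by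
  refine hT x fun n => ?_
  obtain ⟨t, ht, y, hy⟩ := h n
  refine ⟨t, ht, ?_⟩
  have := eval_pow_smul n y
  rw [← hy, map_sub, sub_eq_zero] at this
  exact this.symm

lemma exists_sub_eq_pow_smul {K : Type*} [Field K] {T : Submodule (ZEll ℓ) (KHat ℓ K)} {x : KHat ℓ K}
    {n : ℕ} (h : ∃ t ∈ T, AdicCompletion.eval (ellIdeal ℓ) (Additive Kˣ) n t =
      AdicCompletion.eval (ellIdeal ℓ) (Additive Kˣ) n x) :
    ∃ t ∈ T, ∃ y, x - t = (ℓ : ZEll ℓ) ^ n • y := by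
  obtain ⟨t, ht, e⟩ := h
  exact ⟨t, ht, exists_eq_pow_smul_of_eval_eq_zero (by rw [map_sub, e, sub_self])⟩

end Completion

/-! ### Modules over `ℤ_ℓ`, closed submodules and dependence -/

section ProEllCase

variable {ℓ : ℕ} [hp : Fact ℓ.Prime]

section Module

variable {M N : Type*} [AddCommGroup M] [Module (ZEll ℓ) M] [AddCommGroup N] [Module (ZEll ℓ) N]

/-- The `ℓ`-adic filtration of `M` is separated. -/
def IsSeparatedModule (ℓ : ℕ) (M : Type*) [AddCommGroup M] [Module (ZEll ℓ) M] : Prop :=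
  ∀ w : M, (∀ n : ℕ, ∃ w', w = (ℓ : ZEll ℓ) ^ n • w') → w = 0

lemma isPrincipal_top_of_injective (f : N →ₗ[ZEll ℓ] M) (hf : Function.Injective f)
    (h : (⊤ : Submodule (ZEll ℓ) M).IsPrincipal) : (⊤ : Submodule (ZEll ℓ) N).IsPrincipal := by
  obtain ⟨g, hg⟩ := h
  obtain ⟨j, hj⟩ := IsPrincipalIdealRing.principal
    ((LinearMap.range f).comap (LinearMap.toSpanSingleton (ZEll ℓ) M g))
  have hjr : j ∈ (LinearMap.range f).comap (LinearMap.toSpanSingleton (ZEll ℓ) M g) := by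
    rw [hj]; exact Submodule.mem_span_singleton_self j
  obtain ⟨n₀, hn₀⟩ := hjr
  refine ⟨n₀, le_antisymm (fun n _ => ?_) le_top⟩
  have hn : f n ∈ (⊤ : Submodule (ZEll ℓ) M) := trivial
  rw [hg, Submodule.mem_span_singleton] at hn
  obtain ⟨a, ha⟩ := hn
  have ha' : a ∈ (LinearMap.range f).comap (LinearMap.toSpanSingleton (ZEll ℓ) M g) := ⟨n, ha.symm⟩
  rw [hj, Submodule.mem_span_singleton] at ha'
  obtain ⟨c, rfl⟩ := ha'
  rw [Submodule.mem_span_singleton]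
  refine ⟨c, hf ?_⟩
  rw [map_smul, hn₀, ← ha, LinearMap.toSpanSingleton_apply, smul_eq_mul, mul_smul]

omit hp in
lemma isPrincipal_span_pair_of_smul {x y : M} {c : ZEll ℓ} (h : x = c • y) :
    (Submodule.span (ZEll ℓ) {x, y}).IsPrincipal :=
  ⟨y, le_antisymm (Submodule.span_le.2 (by
    rintro z (rfl | rfl)
    · rw [h]; exact Submodule.smul_mem _ _ (Submodule.mem_span_singleton_self y)
    · exact Submodule.mem_span_singleton_self _)) (Submodule.span_mono (by simp))⟩

omit hp in
lemma exists_smul_of_isPrincipal_span_pair {x y : M}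
    (h : (Submodule.span (ZEll ℓ) {x, y}).IsPrincipal) :
    ∃ (z : M) (a b : ZEll ℓ), x = a • z ∧ y = b • z := by
  obtain ⟨z, hz⟩ := h
  have hx : x ∈ Submodule.span (ZEll ℓ) {x, y} := Submodule.subset_span (by simp)
  have hy : y ∈ Submodule.span (ZEll ℓ) {x, y} := Submodule.subset_span (by simp)
  rw [hz, Submodule.mem_span_singleton] at hx hy
  obtain ⟨a, ha⟩ := hx
  obtain ⟨b, hb⟩ := hy
  exact ⟨z, a, b, ha.symm, hb.symm⟩

variable [htf : Module.IsTorsionFree (ZEll ℓ) M]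

lemma exists_smul_of_dependent {x y : M} {a b : ZEll ℓ} (hab : a ≠ 0 ∨ b ≠ 0)
    (h : a • x + b • y = 0) : (∃ c : ZEll ℓ, x = c • y) ∨ ∃ c : ZEll ℓ, y = c • x := by
  rcases ZEll.dvd_or_dvd a b with ⟨c, rfl⟩ | ⟨c, rfl⟩
  · have ha : a ≠ 0 := hab.elim id left_ne_zero_of_mul
    rw [mul_smul, ← smul_add, smul_eq_zero_iff_right ha] at h
    exact Or.inl ⟨-c, by rw [neg_smul]; exact eq_neg_of_add_eq_zero_left h⟩
  · have hb : b ≠ 0 := hab.elim left_ne_zero_of_mul id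
    rw [mul_smul, ← smul_add, smul_eq_zero_iff_right hb] at h
    exact Or.inr ⟨-c, by rw [neg_smul]; exact eq_neg_of_add_eq_zero_right h⟩

/-- For `m` not divisible by `ℓ` in a torsion-free module, `c • m` is no more divisible than `c`:
cancel the power of `ℓ` in `c` and invert its unit part. -/
lemma pow_dvd_of_smul_eq {m w : M} (hm : ∀ w, m ≠ (ℓ : ZEll ℓ) • w) {c : ZEll ℓ} {n : ℕ}
    (h : c • m = (ℓ : ZEll ℓ) ^ n • w) : (ℓ : ZEll ℓ) ^ n ∣ c := by
  by_cases hc : c = 0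
  · rw [hc]; exact dvd_zero _
  obtain ⟨k, u, hu, rfl⟩ := ZEll.exists_eq_pow_mul hc
  rcases le_or_gt n k with hnk | hnk
  · exact (pow_dvd_pow _ hnk).mul_right _
  exfalso
  obtain ⟨d, rfl⟩ := Nat.exists_eq_add_of_lt hnk
  have hℓ0 : (ℓ : ZEll ℓ) ≠ 0 := by
    have := ZEll.intCast_ne_zero (ℓ := ℓ) (m := ℓ) (by exact_mod_cast hp.out.ne_zero)
    rwa [Int.cast_natCast] at this
  have h1 : (ℓ : ZEll ℓ) ^ k • (u • m - (ℓ : ZEll ℓ) ^ (d + 1) • w) = 0 := by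
    rw [smul_sub, smul_smul, smul_smul, ← pow_add, h, sub_eq_zero]
    rfl
  rw [smul_eq_zero_iff_right (pow_ne_zero k hℓ0), sub_eq_zero] at h1
  obtain ⟨v, hv⟩ := hu.exists_left_inv
  apply hm ((v * (ℓ : ZEll ℓ) ^ d) • w)
  rw [smul_smul]
  have : (ℓ : ZEll ℓ) * (v * (ℓ : ZEll ℓ) ^ d) = v * (ℓ : ZEll ℓ) ^ (d + 1) := by ring
  rw [this, mul_smul, ← h1, smul_smul, hv, one_smul]

omit hp htf in
lemma IsSeparatedModule.exists_primitive (hM : IsSeparatedModule ℓ M) {m : M} (hm : m ≠ 0) :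
    ∃ (n : ℕ) (m₁ : M), m = (ℓ : ZEll ℓ) ^ n • m₁ ∧ ∀ w, m₁ ≠ (ℓ : ZEll ℓ) • w := by
  classical
  have h : ∃ n : ℕ, ¬ ∃ w, m = (ℓ : ZEll ℓ) ^ n • w := by
    by_contra! hc
    exact hm (hM m hc)
  obtain ⟨n, hn⟩ : ∃ n, Nat.find h = n + 1 := by
    refine Nat.exists_eq_succ_of_ne_zero fun h0 => ?_
    have := Nat.find_spec h
    rw [h0, pow_zero] at this
    exact this ⟨m, (one_smul _ _).symm⟩
  obtain ⟨m₁, hm₁⟩ : ∃ w, m = (ℓ : ZEll ℓ) ^ n • w := by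
    by_contra hc
    exact Nat.find_min h (m := n) (by omega) hc
  refine ⟨n, m₁, hm₁, fun w hw => ?_⟩
  have h2 := Nat.find_spec h
  rw [hn] at h2
  exact h2 ⟨w, by rw [hm₁, hw, smul_smul, pow_succ]⟩

end Module

section Closed

variable {K : Type*} [Field K] {T : Submodule (ZEll ℓ) (KHat ℓ K)}

omit hp in
lemma IsClosedSub.isSeparatedModule (hT : IsClosedSub T) : IsSeparatedModule ℓ (KHat ℓ K ⧸ T) := by
  intro w hw
  obtain ⟨x, rfl⟩ := T.mkQ_surjective w
  rw [Submodule.mkQ_apply, Submodule.Quotient.mk_eq_zero]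
  refine hT.mem fun n => ?_
  obtain ⟨w', hw'⟩ := hw n
  obtain ⟨y, rfl⟩ := T.mkQ_surjective w'
  rw [← map_smul, Submodule.mkQ_apply, Submodule.mkQ_apply, Submodule.Quotient.eq] at hw'
  exact ⟨_, hw', y, by abel⟩

/-- Approximations of `x` modulo `T` by `r n • h₁` have Cauchy coefficients, because the class of
`h₁` is primitive. The limit coefficient gives `x` exactly, the quotient by `T` being separated. -/
lemma isClosedSub_sup_span (hT : IsClosedSub T) [Module.IsTorsionFree (ZEll ℓ) (KHat ℓ K ⧸ T)]
    {h₁ : KHat ℓ K} (hm : ∀ w, T.mkQ h₁ ≠ (ℓ : ZEll ℓ) • w) :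
    IsClosedSub (T ⊔ Submodule.span (ZEll ℓ) {h₁}) := by
  intro x hx
  have h1 : ∀ n : ℕ, ∃ (r : ZEll ℓ) (w : KHat ℓ K ⧸ T),
      T.mkQ x - r • T.mkQ h₁ = (ℓ : ZEll ℓ) ^ n • w := by
    intro n
    obtain ⟨t, ht, y, hy⟩ := exists_sub_eq_pow_smul (hx n)
    obtain ⟨t₀, ht₀, s, hs, rfl⟩ := Submodule.mem_sup.1 ht
    obtain ⟨r, rfl⟩ := Submodule.mem_span_singleton.1 hs
    refine ⟨r, T.mkQ y, ?_⟩
    rw [← map_smul, ← map_sub, ← map_smul, ← hy, Submodule.mkQ_apply, Submodule.mkQ_apply,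
      Submodule.Quotient.eq]
    have : x - r • h₁ - (x - (t₀ + r • h₁)) = t₀ := by abel
    rwa [this]
  choose r w hrw using h1
  obtain ⟨s, hs⟩ := ZEll.exists_limit r (fun n m hnm => by
    obtain ⟨d, rfl⟩ := Nat.exists_eq_add_of_le hnm
    refine pow_dvd_of_smul_eq hm (w := (ℓ : ZEll ℓ) ^ d • w (n + d) - w n) ?_
    rw [smul_sub, smul_smul, ← pow_add, ← hrw, ← hrw, sub_smul]
    abel)
  have h2 : T.mkQ x - s • T.mkQ h₁ = 0 := by
    refine hT.isSeparatedModule _ fun n => ?_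
    obtain ⟨c, hc⟩ := hs n
    refine ⟨w n - c • T.mkQ h₁, ?_⟩
    rw [smul_sub, smul_smul, ← hc, ← hrw, sub_smul]
    abel
  rw [← map_smul, ← map_sub, Submodule.mkQ_apply, Submodule.Quotient.mk_eq_zero] at h2
  have : x = (x - s • h₁) + s • h₁ := by abel
  rw [this]
  exact Submodule.add_mem_sup h2 (Submodule.smul_mem _ _ (Submodule.mem_span_singleton_self _))

/-- If `𝐇(T) = T`, then `x` and `1 - x` are dependent modulo `T`. -/
lemma exists_smul_add_smul_of_boldHHat_eq (hT : boldHHat T = T) {x y : Kˣ}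
    (hxy : (y : K) = 1 - x) :
    ∃ a b : ZEll ℓ, (a ≠ 0 ∨ b ≠ 0) ∧ a • toHat ℓ x + b • toHat ℓ y ∈ T := by
  by_cases hxT : toHat ℓ x ∈ T
  · exact ⟨1, 0, Or.inl one_ne_zero, by rwa [one_smul, zero_smul, add_zero]⟩
  have hsep : ∀ w, w ∉ T → ∃ H, w ∉ H ∧ IsTorsionFreeCocyclic T H ∧
      ∀ H', IsTorsionFreeCocyclic T H' → IsRigidHat (H ⊓ H') := by
    intro w hw
    rw [← hT, boldHHat, Submodule.mem_sInf] at hw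
    push Not at hw
    obtain ⟨H, hH, hwH⟩ := hw
    exact ⟨H, hwH, hH⟩
  obtain ⟨H, hxH, ⟨hTH, -, htf, hpr⟩, hrig⟩ := hsep _ hxT
  obtain ⟨g, hg⟩ := hpr
  have hgen : ∀ w, ∃ a : ZEll ℓ, a • g = H.mkQ w := by
    intro w
    rw [← Submodule.mem_span_singleton, ← hg]
    trivial
  obtain ⟨p, hpx⟩ := hgen (toHat ℓ x)
  obtain ⟨q, hqy⟩ := hgen (toHat ℓ y)
  have hp0 : p ≠ 0 := by
    rintro rfl
    rw [zero_smul, eq_comm, Submodule.mkQ_apply, Submodule.Quotient.mk_eq_zero] at hpx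
    exact hxH hpx
  -- These coefficients put the combination in `H`, where `x` and `y` are `p` and `q` times one
  -- generator. Membership in every cocyclic `H'` then follows from rigidity of `H ⊓ H'`.
  refine ⟨-q, p, Or.inr hp0, ?_⟩
  by_contra hw
  obtain ⟨H', hwH', hH', -⟩ := hsep _ hw
  obtain ⟨z, a, b, hxz, hyz⟩ := exists_smul_of_isPrincipal_span_pair
    (hrig H' hH' x y hxy fun hc => hxH hc.1)
  obtain ⟨z, rfl⟩ := (H ⊓ H').mkQ_surjective z
  rw [← map_smul, Submodule.mkQ_apply, Submodule.mkQ_apply, Submodule.Quotient.eq] at hxz hyz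
  have hmod : (-q • toHat ℓ x + p • toHat ℓ y) - (p * b - q * a) • z ∈ H ⊓ H' := by
    have := (H ⊓ H').add_mem ((H ⊓ H').smul_mem (-q) hxz) ((H ⊓ H').smul_mem p hyz)
    convert this using 1
    module
  have hwH : -q • toHat ℓ x + p • toHat ℓ y ∈ H := by
    rw [← Submodule.Quotient.mk_eq_zero, ← Submodule.mkQ_apply, map_add, map_smul, map_smul,
      ← hpx, ← hqy]
    module
  have hzH : (p * b - q * a) • H.mkQ z = 0 := by
    rw [← map_smul, Submodule.mkQ_apply, Submodule.Quotient.mk_eq_zero]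
    have := H.sub_mem hwH hmod.1
    rwa [sub_sub_cancel] at this
  rcases smul_eq_zero.1 hzH with h0 | h0
  · rw [h0, zero_smul, sub_zero] at hmod
    exact hwH' hmod.2
  · rw [Submodule.mkQ_apply, Submodule.Quotient.mk_eq_zero] at h0
    apply hxH
    have := H.add_mem hxz.1 (H.smul_mem a h0)
    rwa [sub_add_cancel] at this

end Closed

end ProEllCase

universe v

/-! ### Passing to a vector space over the fraction field -/

section FractionField

lemma exists_fractionRing_module (R : Type u) [CommRing R] [IsDomain R] (M : Type v)
    [AddCommGroup M] [Module R M] [Module.IsTorsionFree R M] :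
    ∃ (V : Type (max u v)) (_ : AddCommGroup V) (_ : Module (FractionRing R) V) (j : M →+ V),
      Function.Injective j ∧ ∀ (r : R) (m : M), j (r • m) = algebraMap R (FractionRing R) r • j m := by
  refine ⟨LocalizedModule (nonZeroDivisors R) M, inferInstance,
    inferInstanceAs (Module (Localization (nonZeroDivisors R)) _),
    (LocalizedModule.mkLinearMap (nonZeroDivisors R) M).toAddMonoidHom, ?_, ?_⟩
  · rw [injective_iff_map_eq_zero]
    intro m hm
    have h : LocalizedModule.mk m (1 : nonZeroDivisors R) = 0 := hm
    rw [← LocalizedModule.zero_mk 1, LocalizedModule.mk_eq] at h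
    obtain ⟨c, hc⟩ := h
    simp only [one_smul, smul_zero] at hc
    have hc0 : (c : R) ≠ 0 := nonZeroDivisors.ne_zero c.2
    exact (smul_eq_zero_iff_right hc0).1 hc
  · intro r m
    change LocalizedModule.mkLinearMap (nonZeroDivisors R) M (r • m) = _
    rw [map_smul]
    exact (IsScalarTower.algebraMap_smul (Localization (nonZeroDivisors R)) r _).symm

end FractionField

/-! ### The pro-`ℓ` case -/

section ProEllMain

variable {ℓ : ℕ} [hp : Fact ℓ.Prime] {K L : Type*} [Field K] [Field L] [Algebra K L]

omit hp in
lemma hatMap_toHat (x : Kˣ) :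
    hatMap ℓ K L (toHat ℓ x) = toHat ℓ (Units.map (algebraMap K L : K →* L) x) := by
  unfold hatMap toHat
  rw [AdicCompletion.map_of]
  rfl

omit hp in
lemma toHat_add (x y : Kˣ) : toHat ℓ (x * y) = toHat ℓ x + toHat ℓ y := by
  simp only [toHat, ofMul_mul, map_add]

omit hp in
lemma isClosedSub_comap {H : Submodule (ZEll ℓ) (KHat ℓ L)} (hH : IsClosedSub H) :
    IsClosedSub (H.comap (hatMap ℓ K L)) := by
  intro x hx
  refine hH _ fun n => ?_
  obtain ⟨t, ht, e⟩ := hx n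
  refine ⟨hatMap ℓ K L t, ht, ?_⟩
  have e' : t.val n = x.val n := e
  change (hatMap ℓ K L t).val n = (hatMap ℓ K L x).val n
  unfold hatMap
  rw [AdicCompletion.map_val_apply, AdicCompletion.map_val_apply, e']

lemma isTorsionFreeCocyclic_comap {T' H : Submodule (ZEll ℓ) (KHat ℓ L)}
    (hH : IsTorsionFreeCocyclic T' H) :
    IsTorsionFreeCocyclic (T'.comap (hatMap ℓ K L)) (H.comap (hatMap ℓ K L)) := by
  obtain ⟨hTH, hcl, htf, hpr⟩ := hH
  let f : (KHat ℓ K ⧸ H.comap (hatMap ℓ K L)) →ₗ[ZEll ℓ] (KHat ℓ L ⧸ H) :=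
    Submodule.mapQ _ H (hatMap ℓ K L) le_rfl
  have hf : Function.Injective f := by
    rw [← LinearMap.ker_eq_bot]
    exact Submodule.ker_liftQ_eq_bot _ _ _ (by rw [LinearMap.ker_comp, Submodule.ker_mkQ])
  exact ⟨Submodule.comap_mono hTH, isClosedSub_comap hcl,
    hf.moduleIsTorsionFree f (fun r m => map_smul f r m), isPrincipal_top_of_injective f hf hpr⟩

/-- Over a valuation ring, two dependent elements of a torsion-free module are such that one is a
multiple of the other. That relation survives in the quotient by `N`, which need not be
torsion-free. -/
lemma isRigidHat_of_dependent {T N : Submodule (ZEll ℓ) (KHat ℓ K)} (hTN : T ≤ N)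
    [Module.IsTorsionFree (ZEll ℓ) (KHat ℓ K ⧸ T)]
    (hdep : ∀ x y : Kˣ, (y : K) = 1 - x →
      ∃ a b : ZEll ℓ, (a ≠ 0 ∨ b ≠ 0) ∧ a • toHat ℓ x + b • toHat ℓ y ∈ T) : IsRigidHat N := by
  intro x y hxy _
  obtain ⟨a, b, hab, h⟩ := hdep x y hxy
  rw [← Submodule.Quotient.mk_eq_zero, ← Submodule.mkQ_apply, map_add, map_smul, map_smul] at h
  have aux : ∀ (u v : KHat ℓ K) (c : ZEll ℓ), T.mkQ u = c • T.mkQ v →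
      N.mkQ u = c • N.mkQ v := by
    intro u v c huv
    rw [← map_smul, Submodule.mkQ_apply, Submodule.mkQ_apply, Submodule.Quotient.eq] at huv ⊢
    exact hTN huv
  rcases exists_smul_of_dependent hab h with ⟨c, hc⟩ | ⟨c, hc⟩
  · exact isPrincipal_span_pair_of_smul (aux _ _ _ hc)
  · rw [Set.pair_comm]
    exact isPrincipal_span_pair_of_smul (aux _ _ _ hc)

/-- In a separated torsion-free module over a valuation ring in which the natural numbers are dense,
the multiples of `m x` by `α / (r + α)` cannot all be integral together with those for `α⁻¹`. -/
lemma eq_zero_of_forall_smul_eq {R k V M A : Type*} [CommRing R] [IsDomain R] [Field k]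
    [Algebra R k] [IsFractionRing R k] [AddCommGroup V] [Module k V] [AddCommGroup M] [Module R M]
    [Module.IsTorsionFree R M] {π : R} (hdvd : ∀ a b : R, a ∣ b ∨ b ∣ a)
    (happrox : ∀ (x : R) (n : ℕ), ∃ r : ℕ, π ^ n ∣ x - r)
    (hsep : ∀ w : M, (∀ n : ℕ, ∃ w', w = π ^ n • w') → w = 0) {j : M →+ V}
    (hj : Function.Injective j) (hjs : ∀ (r : R) (m : M), j (r • m) = algebraMap R k r • j m)
    (m : A → M) {α : k} (hα : α ≠ 0) (x : A)
    (h1 : ∀ r : ℕ, ∃ z, ((r : k) + α) • j (m z) = α • j (m x))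
    (h2 : ∀ r : ℕ, ∃ z, ((r : k) + α⁻¹) • j (m z) = α⁻¹ • j (m x)) : j (m x) = 0 := by
  have main : ∀ p : R, p ≠ 0 →
      (∀ r : ℕ, ∃ z, ((r : k) + algebraMap R k p) • j (m z) = algebraMap R k p • j (m x)) →
      j (m x) = 0 := by
    intro p hp0 h
    have : p • m x = 0 := by
      refine hsep _ fun n => ?_
      -- With `r` close to `-p` the denominator `r + p` is divisible by `π ^ n`, hence so is `p • m
      -- x`, for every `n`.
      obtain ⟨r, c, hc⟩ := happrox (-p) n
      obtain ⟨z, hz⟩ := h r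
      rw [← map_natCast (algebraMap R k), ← map_add, ← hjs, ← hjs] at hz
      refine ⟨-c • m z, ?_⟩
      rw [← hj hz, smul_smul]
      congr 1
      linear_combination -hc
    rw [(smul_eq_zero_iff_right hp0).1 this, map_zero]
  obtain ⟨p, q, hq, rfl⟩ := IsFractionRing.div_surjective (A := R) α
  have hq0 : algebraMap R k q ≠ 0 := by
    intro hc
    rw [hc, div_zero] at hα
    exact hα rfl
  have hp0 : algebraMap R k p ≠ 0 := by
    intro hc
    rw [hc, zero_div] at hα
    exact hα rfl
  rcases hdvd q p with ⟨c, rfl⟩ | ⟨c, rfl⟩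
  · rw [map_mul] at hp0
    have e : algebraMap R k (q * c) / algebraMap R k q = algebraMap R k c := by
      rw [map_mul, mul_div_cancel_left₀ _ hq0]
    rw [e] at h1
    exact main c (by rintro rfl; simp at hp0) h1
  · rw [map_mul] at hq0
    have e : (algebraMap R k p / algebraMap R k (p * c))⁻¹ = algebraMap R k c := by
      rw [inv_div, map_mul, mul_div_cancel_left₀ _ hp0]
    rw [e] at h2
    exact main c (by rintro rfl; simp at hq0) h2

/-- A closed subgroup `H` with `H / T` cyclic containing all elements of a set whose images modulo
`T` are pairwise dependent. -/
lemma exists_isClosedSub_of_dependent {T : Submodule (ZEll ℓ) (KHat ℓ K)} (hT : IsClosedSub T)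
    [Module.IsTorsionFree (ZEll ℓ) (KHat ℓ K ⧸ T)] (S : Set (KHat ℓ K))
    (hS : ∀ x ∈ S, ∀ y ∈ S, x ∉ T → ∃ a b : ZEll ℓ, b ≠ 0 ∧ b • y - a • x ∈ T) :
    ∃ H : Submodule (ZEll ℓ) (KHat ℓ K), IsClosedSub H ∧ T ≤ H ∧ (H.map T.mkQ).IsPrincipal ∧
      S ⊆ H := by
  by_cases hex : ∃ x ∈ S, x ∉ T
  · obtain ⟨x, hxS, hxT⟩ := hex
    have hx0 : T.mkQ x ≠ 0 := by
      rwa [Submodule.mkQ_apply, Ne, Submodule.Quotient.mk_eq_zero]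
    -- Dividing `x` by the largest possible power of `ℓ` gives a generator of which every `y`
    -- dependent on `x` is an integral multiple.
    obtain ⟨n, m₁, hm, hprim⟩ := hT.isSeparatedModule.exists_primitive hx0
    obtain ⟨h₁, rfl⟩ := T.mkQ_surjective m₁
    refine ⟨T ⊔ Submodule.span (ZEll ℓ) {h₁}, isClosedSub_sup_span hT hprim, le_sup_left, ?_, ?_⟩
    · refine ⟨T.mkQ h₁, ?_⟩
      rw [Submodule.map_sup, Submodule.map_span, Set.image_singleton, Submodule.mkQ_map_self,
        bot_sup_eq]
    · intro y hy
      obtain ⟨a, b, hb, hab⟩ := hS x hxS y hy hxT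
      have key : ∃ c : ZEll ℓ, T.mkQ y = c • T.mkQ h₁ := by
        rw [← Submodule.Quotient.mk_eq_zero, ← Submodule.mkQ_apply, map_sub, map_smul, map_smul,
          hm, smul_smul, sub_eq_add_neg, ← neg_smul] at hab
        rcases exists_smul_of_dependent (Or.inl hb) hab with h | ⟨c, hc⟩
        · exact h
        · have hcu : IsUnit c := by
            refine (ZEll.isLocalRing_and_isUnit_or_dvd.2 c).resolve_right ?_
            rintro ⟨d, rfl⟩
            exact hprim (d • T.mkQ y) (by rw [hc, mul_smul])
          obtain ⟨v, hv⟩ := hcu.exists_left_inv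
          exact ⟨v, by rw [hc, smul_smul, hv, one_smul]⟩
      obtain ⟨c, hc⟩ := key
      rw [← map_smul, Submodule.mkQ_apply, Submodule.mkQ_apply, Submodule.Quotient.eq] at hc
      have : y = (y - c • h₁) + c • h₁ := by abel
      rw [this]
      exact Submodule.add_mem_sup hc (Submodule.smul_mem _ _ (Submodule.mem_span_singleton_self _))
  · push Not at hex
    exact ⟨T, hT, le_rfl, by rw [Submodule.mkQ_map_self]; exact bot_isPrincipal, hex⟩

/-- The extension `L` enters only through the `ℓ ^ n`-th roots, for all `n`, of the elements of
`capUnits T`. -/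
theorem boldHHat_eq_and_exists_valuation (hℓ0 : (ℓ : K) ≠ 0) {T : Submodule (ZEll ℓ) (KHat ℓ K)} (hT : IsClosedSub T)
    [Module.IsTorsionFree (ZEll ℓ) (KHat ℓ K ⧸ T)]
    (hroot : ∀ t ∈ capUnits T, ∀ n : ℕ, ∃ y : L, y ^ ℓ ^ n = algebraMap K L (t : K))
    {T' : Submodule (ZEll ℓ) (KHat ℓ L)} (hT' : IsClosedSub T')
    [Module.IsTorsionFree (ZEll ℓ) (KHat ℓ L ⧸ T')] (hcomap : T'.comap (hatMap ℓ K L) = T)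
    (hbT' : boldHHat T' = T') :
    boldHHat T = T ∧ ∃ H : Submodule (ZEll ℓ) (KHat ℓ K), IsClosedSub H ∧ T ≤ H ∧
      (H.map T.mkQ).IsPrincipal ∧ IsValuative (capUnits H) ∧
      ∃ A : ValuationSubring K, IsCanonicalValuation A (capUnits H) ∧
        A.principalUnitGroup ≤ capUnits T ∧ A.unitGroup ≤ capUnits H ∧
        ringChar (IsLocalRing.ResidueField A) ≠ ℓ := by
  set ι : Kˣ →* Lˣ := Units.map (algebraMap K L : K →* L) with hι
  have hmem : ∀ x, x ∈ T ↔ hatMap ℓ K L x ∈ T' := fun x => by rw [← hcomap]; rfl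
  have hdepL : ∀ x y : Lˣ, (y : L) = 1 - x →
      ∃ a b : ZEll ℓ, (a ≠ 0 ∨ b ≠ 0) ∧ a • toHat ℓ x + b • toHat ℓ y ∈ T' :=
    fun x y hxy => exists_smul_add_smul_of_boldHHat_eq hbT' hxy
  refine ⟨le_antisymm ?_ (le_sInf fun H hH => hH.1.1), ?_⟩
  · intro x hx
    rw [hmem, ← hbT', boldHHat, Submodule.mem_sInf]
    intro H hH
    refine (Submodule.mem_sInf.1 hx (H.comap (hatMap ℓ K L)) ⟨?_, ?_⟩ :
      x ∈ H.comap (hatMap ℓ K L))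
    · rw [← hcomap]
      exact isTorsionFreeCocyclic_comap hH.1
    · intro H' hH'
      refine isRigidHat_of_dependent (T := T) (le_inf ?_ hH'.1) fun a b hab => ?_
      · rw [← hcomap]
        exact Submodule.comap_mono hH.1.1
      · obtain ⟨c, d, hcd, h⟩ := hdepL (ι a) (ι b) (by simp [hι, hab])
        refine ⟨c, d, hcd, ?_⟩
        rwa [hmem, map_add, map_smul, map_smul, hatMap_toHat, hatMap_toHat]
  obtain ⟨V, _, _, j, hj, hjs⟩ := exists_fractionRing_module (ZEll ℓ) (KHat ℓ L ⧸ T')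
  let m : Additive Lˣ →+ KHat ℓ L ⧸ T' :=
    { toFun := fun u => T'.mkQ (toHat ℓ u.toMul)
      map_zero' := by simp [toHat]
      map_add' := fun u w => by rw [toMul_add, toHat_add, map_add] }
  have hm : ∀ u : Lˣ, m (Additive.ofMul u) = T'.mkQ (toHat ℓ u) := fun u => rfl
  have hm0 : ∀ u : Lˣ, m (Additive.ofMul u) = 0 ↔ toHat ℓ u ∈ T' := fun u => by
    rw [hm, Submodule.mkQ_apply, Submodule.Quotient.mk_eq_zero]
  have hψ : ∀ u : Lˣ, (j.comp m) (Additive.ofMul u) = 0 ↔ toHat ℓ u ∈ T' := fun u => by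
    rw [AddMonoidHom.comp_apply, map_eq_zero_iff j hj, hm0]
  have hinj := IsFractionRing.injective (ZEll ℓ) (FractionRing (ZEll ℓ))
  have hinj0 : ∀ r : ZEll ℓ, r ≠ 0 → algebraMap (ZEll ℓ) (FractionRing (ZEll ℓ)) r ≠ 0 :=
    fun r hr => (map_ne_zero_iff _ hinj).2 hr
  have h2 : (2 : ZEll ℓ) ≠ 0 := by
    have := ZEll.intCast_ne_zero (ℓ := ℓ) (m := 2) two_ne_zero
    simpa using this
  obtain ⟨B, hB, hB1, v, hB2⟩ := exists_valuationSubring_of_unitLog (K := K)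
    (k := FractionRing (ZEll ℓ)) (ψ := j.comp m) hp.out hℓ0
    (by
      rw [hψ, ← hm0]
      -- Torsion-freeness kills `-1`, which need not be assumed to lie in `T'`.
      have h3 : (2 : ZEll ℓ) • m (Additive.ofMul (-1)) = 0 := by
        rw [two_smul, ← map_add, ← ofMul_mul, neg_mul_neg, one_mul, ofMul_one, map_zero]
      exact (smul_eq_zero_iff_right h2).1 h3)
    (by
      intro x y hxy
      obtain ⟨a, b, hab, h⟩ := hdepL x y hxy
      refine ⟨_, _, hab.imp (hinj0 a) (hinj0 b), ?_⟩
      rw [AddMonoidHom.comp_apply, AddMonoidHom.comp_apply, ← hjs, ← hjs, ← map_add, hm, hm,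
        ← map_smul, ← map_smul, ← map_add, Submodule.mkQ_apply, (Submodule.Quotient.mk_eq_zero T').2 h,
        map_zero])
    (fun α hα x h3 h4 => eq_zero_of_forall_smul_eq ZEll.dvd_or_dvd ZEll.exists_natCast
      hT'.isSeparatedModule hj hjs m hα x h3 h4)
    (Or.inl (by
      have := hinj0 2 h2
      rwa [map_ofNat] at this))
    -- All roots are needed: the image is killed by being divisible by every `ℓ ^ n` in a separated
    -- module.
    Set.univ
    (by
      intro n _ t ht
      rw [hψ, ← hatMap_toHat, ← hmem] at ht
      exact hroot t ht n)
    (by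
      intro x h
      rw [AddMonoidHom.comp_apply, hT'.isSeparatedModule (m x), map_zero]
      intro n
      obtain ⟨d, hd⟩ := h n trivial
      refine ⟨m d, hj ?_⟩
      rw [AddMonoidHom.comp_apply, AddMonoidHom.comp_apply] at hd
      rw [hd, hjs, map_pow, map_natCast, ← Nat.cast_pow, Nat.cast_smul_eq_nsmul])
  -- The units of `B` map into one line over the fraction field; clearing denominators makes their
  -- images modulo `T` pairwise dependent over `ℤ_ℓ`.
  obtain ⟨H, hHc, hTH, hHp, hSH⟩ := exists_isClosedSub_of_dependent hT
    (toHat ℓ '' (B.unitGroup : Set Kˣ)) (by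
      rintro _ ⟨u, hu, rfl⟩ _ ⟨w, hw, rfl⟩ huT
      obtain ⟨c, hc⟩ := hB2 u hu
      obtain ⟨d, hd⟩ := hB2 w hw
      have hc0 : c ≠ 0 := by
        rintro rfl
        rw [zero_smul, hψ, ← hatMap_toHat, ← hmem] at hc
        exact huT hc
      obtain ⟨a, b, hb, e⟩ := IsFractionRing.div_surjective (A := ZEll ℓ) (d / c)
      have hb0 : b ≠ 0 := nonZeroDivisors.ne_zero hb
      refine ⟨a, b, hb0, ?_⟩
      have hb1 := hinj0 b hb0
      have h5 : algebraMap (ZEll ℓ) (FractionRing (ZEll ℓ)) b * d =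
          algebraMap (ZEll ℓ) (FractionRing (ZEll ℓ)) a * c := by
        field_simp at e
        linear_combination -e
      rw [hmem, map_sub, map_smul, map_smul, hatMap_toHat, hatMap_toHat,
        ← Submodule.Quotient.mk_eq_zero, ← Submodule.mkQ_apply, map_sub, map_smul, map_smul,
        ← hm, ← hm, sub_eq_zero]
      apply hj
      rw [hjs, hjs]
      rw [AddMonoidHom.comp_apply] at hc hd
      rw [hc, hd, smul_smul, smul_smul, h5])
  refine ⟨H, hHc, hTH, hHp, exists_canonical_of_unitGroup_le hℓ0 hB (fun u hu => ?_)
    (fun u hu => hSH ⟨u, hu, rfl⟩)⟩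
  have := hB1 u hu
  rw [hψ, ← hatMap_toHat, ← hmem] at this
  exact this

end ProEllMain

/-! ### Roots in the Kummer extensions -/

section KummerRoots

variable {K : Type*} [Field K] {ℓ : ℕ} [hp : Fact ℓ.Prime] {T : Subgroup Kˣ}

lemma exists_root_kummerExt {t : Kˣ} (ht : t ∈ T) :
    ∃ y : kummerExt ℓ T, y ^ ℓ = algebraMap K (kummerExt ℓ T) (t : K) := by
  obtain ⟨y, hy⟩ := IsAlgClosed.exists_pow_nat_eq (algebraMap K (AlgebraicClosure K) (t : K))
    hp.out.pos
  exact ⟨⟨y, IntermediateField.subset_adjoin K _ ⟨t, ht, hy⟩⟩, Subtype.ext hy⟩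

lemma exists_root_kummerExtInfty {t : Kˣ} (ht : t ∈ T) (n : ℕ) :
    ∃ y : kummerExtInfty ℓ T, y ^ ℓ ^ n = algebraMap K (kummerExtInfty ℓ T) (t : K) := by
  obtain ⟨y, hy⟩ := IsAlgClosed.exists_pow_nat_eq (algebraMap K (AlgebraicClosure K) (t : K))
    (pow_pos hp.out.pos n)
  exact ⟨⟨y, IntermediateField.subset_adjoin K _ ⟨n, t, ht, hy⟩⟩, Subtype.ext hy⟩

omit hp in
lemma natCast_ne_zero_of_ringChar_ne (hℓ : ℓ.Prime) (hchar : ringChar K ≠ ℓ) : (ℓ : K) ≠ 0 := by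
  intro h
  rcases (Nat.dvd_prime hℓ).1 (ringChar.dvd h) with h1 | h1
  · exact CharP.ringChar_ne_one h1
  · exact hchar h1

end KummerRoots

end RigidVal

open RigidVal
theorem mainTheorem12 {K : Type*} [Field K] (ℓ : ℕ) [Fact ℓ.Prime]
    (hchar : ringChar K ≠ ℓ) (hμ : ∃ ζ : K, IsPrimitiveRoot ζ ℓ) :
    (∀ T : Subgroup Kˣ, (-1 : Kˣ) ∈ T →
      ∀ T' : Subgroup (kummerExt ℓ T)ˣ,
        (∀ y : (kummerExt ℓ T)ˣ, y ^ ℓ ∈ T') →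
        T'.comap (Units.map (algebraMap K (kummerExt ℓ T) : K →* kummerExt ℓ T)) = T →
        boldH T' = T' →
        boldH T = T ∧
        ∃ H : Subgroup Kˣ, T ≤ H ∧ IsCyclic (H ⧸ T.subgroupOf H) ∧ IsValuative H ∧
          ∃ A : ValuationSubring K, IsCanonicalValuation A H ∧
            A.principalUnitGroup ≤ T ∧ A.unitGroup ≤ H ∧
            ringChar (IsLocalRing.ResidueField A) ≠ ℓ) ∧
    ((∀ n : ℕ, ∃ ζ : K, IsPrimitiveRoot ζ (ℓ ^ n)) →
      ∀ T : Submodule (ZEll ℓ) (KHat ℓ K), IsClosedSub T →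
        Module.IsTorsionFree (ZEll ℓ) (KHat ℓ K ⧸ T) →
        ∀ T' : Submodule (ZEll ℓ) (KHat ℓ (kummerExtInfty ℓ (capUnits T))), IsClosedSub T' →
          Module.IsTorsionFree (ZEll ℓ) (KHat ℓ (kummerExtInfty ℓ (capUnits T)) ⧸ T') →
          T'.comap (hatMap ℓ K (kummerExtInfty ℓ (capUnits T))) = T →
          boldHHat T' = T' →
          boldHHat T = T ∧
          ∃ H : Submodule (ZEll ℓ) (KHat ℓ K), IsClosedSub H ∧ T ≤ H ∧
            (H.map T.mkQ).IsPrincipal ∧ IsValuative (capUnits H) ∧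
            ∃ A : ValuationSubring K, IsCanonicalValuation A (capUnits H) ∧
              A.principalUnitGroup ≤ capUnits T ∧ A.unitGroup ≤ capUnits H ∧
              ringChar (IsLocalRing.ResidueField A) ≠ ℓ) := by
  have hℓ : ℓ.Prime := Fact.out
  have hℓ0 : (ℓ : K) ≠ 0 := natCast_ne_zero_of_ringChar_ne hℓ hchar
  refine ⟨fun T hneg T' hpow hcomap hT' =>
    boldH_eq_and_exists_valuation hℓ hℓ0 hneg (fun t ht => exists_root_kummerExt ht) hpow hcomap hT', ?_⟩
  intro _ T hT htf T' hT' htf' hcomap hbT'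
  exact boldHHat_eq_and_exists_valuation hℓ0 hT (fun t ht n => exists_root_kummerExtInfty ht n) hT' hcomap hbT'
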